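/- Let $\mathcal H$ be an infinite-dimensional complex Hilbert space (not necessarily separable), and let $\mathbf A=(A_1,\dots,A_m)$ be an $m$-tuple of bounded linear operators of finite rank on $\mathcal H$. For a positive integer $k$ let $$W_k(\mathbf A)=\left\{\left(\sum_{\ell=1}^k\langle A_1x_\ell,x_\ell\rangle,\dots,\sum_{\ell=1}^k\langle A_mx_\ell,x_\ell\rangle\right):\{x_1,\dots,x_k\}\subseteq\mathcal H\text{ is an orthonormal set}\right\}\subseteq\mathbb C^m .$$ A subset of $\mathbb C^m$ is called polyhedral if it is the convex hull of a finite set. Let $r$ be the dimension of the sum of the range spaces of $A_1,\dots,A_m$, and fix any orthonormal basis $(e_i)_{i\in I}$ of $\mathcal H$; an operator $D$ is called diagonal if every $e_i$ is an eigenvector of $D$, i.e. $De_i=d_ie_i$ for some $d_i\in\mathbb C$. Then the following conditions are equivalent. (a) $\{A_1,\dots,A_m\}$ is a commuting family of normal operators. (a') There is a unitary operator $U$ on $\mathcal H$ such that $U^*A_jU$ is a diagonal operator for each $j=1,\dots,m$. (b) For every positive integer $k$, $W_k(\mathbf A)$ is closed and polyhedral. (c) There is a positive integer $k\ge r$ such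 that $\operatorname{conv}W_k(\mathbf A)$ is polyhedral. -/

import Mathlib

/-- The joint `k`-numerical range of a tuple `A` of bounded operators: the set of all
`(∑ l, ⟨A₁ x_l, x_l⟩, …, ∑ l, ⟨A_m x_l, x_l⟩)`, where `x` runs over the orthonormal systems of
`k` vectors.  Mathlib's inner product is linear in its second argument, so that `⟨A x, x⟩`
(linear in the first argument) is `inner ℂ x (A x)`. -/
def kNumericalRange {H : Type*} [NormedAddCommGroup H] [InnerProductSpace ℂ H] {m : ℕ}
    (k : ℕ) (A : Fin m → H →L[ℂ] H) : Set (Fin m → ℂ) :=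
  {v | ∃ x : Fin k → H, Orthonormal ℂ x ∧ ∀ j, v j = ∑ l, inner ℂ (x l) (A j (x l))}

/-- A subset of `ℂ^m` is polyhedral if it is the (real) convex hull of a finite set. -/
def IsPolyhedral {m : ℕ} (S : Set (Fin m → ℂ)) : Prop :=
  ∃ F : Set (Fin m → ℂ), F.Finite ∧ S = convexHull ℝ F

/-- A commuting family of normal operators. -/
def IsCommutingNormalFamily {H : Type*} [NormedAddCommGroup H] [InnerProductSpace ℂ H]
    [CompleteSpace H] {m : ℕ} (A : Fin m → H →L[ℂ] H) : Prop :=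
  (∀ j, IsStarNormal (A j)) ∧ ∀ i j, Commute (A i) (A j)

/-- An operator is diagonal relative to the orthonormal basis `e` if every vector of the basis is
an eigenvector. -/
def IsDiagonalOperator {H : Type*} [NormedAddCommGroup H] [InnerProductSpace ℂ H]
    {ι : Type*} (e : HilbertBasis ι ℂ H) (D : H →L[ℂ] H) : Prop :=
  ∃ d : ι → ℂ, ∀ i, D (e i) = d i • e i

/-- The dimension of the sum of the ranges of the operators `A j`. -/
noncomputable def rangeSumDim {H : Type*} [NormedAddCommGroup H] [InnerProductSpace ℂ H] {m : ℕ}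
    (A : Fin m → H →L[ℂ] H) : ℕ :=
  Module.finrank ℂ (⨆ j, LinearMap.range (A j : H →ₗ[ℂ] H) : Submodule ℂ H)

/-! ### Orthonormal systems, their spans, and a quadratic inequality. -/

open scoped InnerProductSpace ComplexStarModule

/-! The substantial direction goes from a polyhedral convex hull to commuting normality. Maximizing
a real functional over `W_k` amounts to maximizing the trace of a compression of a hermitian
combination `X` of the `A_j`. All these `X` have zero quadratic form on the orthogonal complement of
the sum `S` of the ranges. Since `k ≥ dim S` and `H` is infinite-dimensional, the projection `P`
onto the span of a maximizer commutes with `X` and satisfies `PX ≥ 0 ≥ (1 - P)X`, so that `PX = X⁺`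
(`IsDiagonalMaximizer.isPositiveSplitting`, `IsPositiveSplitting.mul_eq_posPart`). A polytope has
finitely many vertices, so finitely many projections serve all `X`. Each vertex is strictly exposed
and stays maximal under small changes of the functional, so its projection commutes with every
hermitian combination. For two combinations `X`, `Y`, turn around the circle `cos t X + sin t Y`:
where two projections both split the same operator, their difference annihilates the commutator `K`
of `X` and `Y`. By connectedness `PK` is the same for all of them; comparing `X` with `-X` then
forces `K = 0` (`commute_of_finite_positiveSplittings`). Conversely, a commuting normal family of
finite-rank operators lives on `S`, where it is jointly diagonalized; equipotence of Hilbert bases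
turns this into a unitary. In an eigenbasis, `W_k` is a linear image of the diagonals of rank-`k`
projections. Finitely many indices matter, and by the finite carpenter theorem
(`exists_orthonormal_of_mem_hypersimplex`) those diagonals fill a hypersimplex, so `W_k` is itself a
polytope and hence closed. -/

theorem exists_unit_mem_orthogonal {H : Type*} [NormedAddCommGroup H] [InnerProductSpace ℂ H]
    (hH : ¬ FiniteDimensional ℂ H) (S : Submodule ℂ H) [FiniteDimensional ℂ S] :
    ∃ w ∈ Sᗮ, ‖w‖ = 1 := by
  have hne : Sᗮ ≠ ⊥ := by
    intro h
    rw [Submodule.orthogonal_eq_bot_iff] at h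
    subst h
    exact hH (LinearEquiv.finiteDimensional (Submodule.topEquiv (R := ℂ) (M := H)))
  obtain ⟨w, hw, hw0⟩ := Submodule.exists_mem_ne_zero_of_ne_bot hne
  exact ⟨((‖w‖⁻¹ : ℝ) : ℂ) • w, Submodule.smul_mem _ _ hw, by
    rw [norm_smul]; simp [norm_ne_zero_iff.mpr hw0]⟩

/-- The sum of the diagonal entries over an orthonormal system depends only on its span. -/
theorem sum_inner_eq_of_span_eq {H : Type*} [NormedAddCommGroup H] [InnerProductSpace ℂ H]
    {k : ℕ} {x y : Fin k → H} (hx : Orthonormal ℂ x) (hy : Orthonormal ℂ y)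
    (h : Submodule.span ℂ (Set.range x) = Submodule.span ℂ (Set.range y)) (X : H →L[ℂ] H) :
    ∑ l, ⟪x l, X (x l)⟫_ℂ = ∑ l, ⟪y l, X (y l)⟫_ℂ := by
  -- The sum is the trace of the compression of `X` to the span.
  have key : ∀ z : Fin k → H, Orthonormal ℂ z → ∀ M : Submodule ℂ H,
      M = Submodule.span ℂ (Set.range z) → ∀ [FiniteDimensional ℂ M],
      ∑ l, ⟪z l, X (z l)⟫_ℂ =
        LinearMap.trace ℂ M (M.orthogonalProjectionOnto ∘L X ∘L M.subtypeL).toLinearMap := by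
    intro z hz M hM _
    have hmem : ∀ l, z l ∈ M := fun l => hM ▸ Submodule.subset_span ⟨l, rfl⟩
    have ho : Orthonormal ℂ (fun l => (⟨z l, hmem l⟩ : M)) := by
      rw [orthonormal_iff_ite] at hz ⊢
      exact hz
    have hsp : ⊤ ≤ Submodule.span ℂ (Set.range (fun l => (⟨z l, hmem l⟩ : M))) := by
      rintro ⟨u, hu⟩ -
      have := hu
      rw [hM] at this
      rw [show z = M.subtype ∘ fun l => (⟨z l, hmem l⟩ : M) from rfl, Set.range_comp,
        ← Submodule.map_span] at this
      obtain ⟨v, hv, hvu⟩ := this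
      rwa [show v = ⟨u, hu⟩ from Subtype.ext hvu] at hv
    rw [LinearMap.trace_eq_sum_inner _ (OrthonormalBasis.mk ho hsp)]
    refine Finset.sum_congr rfl fun l _ => ?_
    simp
  have : FiniteDimensional ℂ (Submodule.span ℂ (Set.range x)) :=
    FiniteDimensional.span_of_finite ℂ (Set.finite_range x)
  rw [key x hx _ rfl, key y hy _ h]

/-- A unit vector in the span of an orthonormal system is a member of another orthonormal system
with the same span. -/
theorem exists_orthonormal_span_eq_mem {H : Type*} [NormedAddCommGroup H] [InnerProductSpace ℂ H]
    {k : ℕ} {x : Fin k → H} (hx : Orthonormal ℂ x) {u : H}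
    (hu : u ∈ Submodule.span ℂ (Set.range x)) (hu1 : ‖u‖ = 1) :
    ∃ y : Fin k → H, Orthonormal ℂ y ∧
      Submodule.span ℂ (Set.range x) = Submodule.span ℂ (Set.range y) ∧ ∃ l, y l = u := by
  have : FiniteDimensional ℂ (Submodule.span ℂ (Set.range x)) :=
    FiniteDimensional.span_of_finite ℂ (Set.finite_range x)
  have hcard : Module.finrank ℂ (Submodule.span ℂ (Set.range x)) = Fintype.card (Fin k) :=
    finrank_span_eq_card hx.linearIndependent
  have hk : 0 < k := by
    rcases Nat.eq_zero_or_pos k with rfl | h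
    · have : u = 0 := by simpa using hu
      simp [this] at hu1
    · exact h
  let l : Fin k := ⟨0, hk⟩
  let v : Fin k → Submodule.span ℂ (Set.range x) := fun _ => ⟨u, hu⟩
  have hv : Orthonormal ℂ (({l} : Set (Fin k)).domRestrict v) := by
    constructor
    · intro i; exact hu1
    · rintro ⟨i, hi⟩ ⟨j, hj⟩ hij
      simp only [Set.mem_singleton_iff] at hi hj
      subst hi; subst hj
      exact absurd rfl hij
  obtain ⟨b, hb⟩ := hv.exists_orthonormalBasis_extension_of_card_eq hcard
  refine ⟨fun i => b i, ?_, ?_, l, by simp [hb l rfl, v]⟩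
  · exact b.orthonormal.comp_linearIsometry (Submodule.span ℂ (Set.range x)).subtypeₗᵢ
  · have h1 := congrArg (Submodule.map (Submodule.span ℂ (Set.range x)).subtype)
      b.toBasis.span_eq
    rw [Submodule.map_span, ← Set.range_comp, Submodule.map_subtype_top] at h1
    refine h1.symm.trans ?_
    congr 2

/-- For small `t` of the sign of `b` the linear term would dominate; `t = b / (1 + |d|)` is small
enough, as `2 (1 + |d|) + d > 0`. -/
theorem eq_zero_and_le_of_forall_quadratic {b d : ℝ} (h : ∀ t : ℝ, 2 * t * b + t ^ 2 * d ≤ 0) :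
    b = 0 ∧ d ≤ 0 := by
  have hd : d ≤ 0 := by nlinarith [h 1, h (-1)]
  refine ⟨?_, hd⟩
  by_contra hb
  have hb2 : 0 < b ^ 2 := by positivity
  have h1 := h (b / (1 + |d|))
  have hp : 0 < 1 + |d| := by positivity
  have h2 : 2 * (b / (1 + |d|)) * b + (b / (1 + |d|)) ^ 2 * d
      = (b ^ 2 * (2 * (1 + |d|) + d)) / (1 + |d|) ^ 2 := by
    field_simp
  rw [h2] at h1
  have : 0 < (b ^ 2 * (2 * (1 + |d|) + d)) / (1 + |d|) ^ 2 := by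
    have := neg_abs_le d
    have := abs_nonneg d
    apply div_pos (mul_pos hb2 (by linarith)) (by positivity)
  linarith

section
variable {H : Type*} [NormedAddCommGroup H] [InnerProductSpace ℂ H]

theorem orthonormal_update {k : ℕ} {x : Fin k → H} (hx : Orthonormal ℂ x) (l : Fin k) {z : H}
    (hz : ‖z‖ = 1) (hzx : ∀ i, i ≠ l → ⟪x i, z⟫_ℂ = 0) :
    Orthonormal ℂ (Function.update x l z) := by
  constructor
  · intro i
    by_cases h : i = l
    · subst h; simpa using hz
    · simpa [h] using hx.1 i
  · intro i j hij
    by_cases h : i = l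
    · subst h
      simp only [Function.update_self, Function.update_of_ne hij.symm]
      rw [← inner_conj_symm, hzx j hij.symm, map_zero]
    · by_cases h' : j = l
      · subst h'
        simp only [Function.update_self, Function.update_of_ne h]
        exact hzx i h
      · simpa [h, h'] using hx.2 hij

theorem re_inner_smul_self (X : H →L[ℂ] H) (c : ℂ) (u : H) :
    (⟪c • u, X (c • u)⟫_ℂ).re = ‖c‖ ^ 2 * (⟪u, X u⟫_ℂ).re := by
  rw [map_smul, inner_smul_left, inner_smul_right, ← mul_assoc, Complex.conj_mul',
    ← Complex.ofReal_pow, Complex.re_ofReal_mul]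

theorem exists_unit_smul {M : Submodule ℂ H} {u : H} (hu : u ∈ M) (h0 : u ≠ 0) :
    ∃ v ∈ M, ‖v‖ = 1 ∧ u = ((‖u‖ : ℝ) : ℂ) • v := by
  have hn : ‖u‖ ≠ 0 := norm_ne_zero_iff.mpr h0
  refine ⟨((‖u‖⁻¹ : ℝ) : ℂ) • u, M.smul_mem _ hu, ?_, ?_⟩
  · rw [norm_smul]; simp [hn]
  · rw [smul_smul, ← Complex.ofReal_mul, mul_inv_cancel₀ hn]; simp

end

/-! ### Maximizers of the trace of a compression. -/

section
variable {H : Type*} [NormedAddCommGroup H] [InnerProductSpace ℂ H] [CompleteSpace H]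

/-- The orthonormal system `x` maximizes the sum of the diagonal entries of `X`. -/
def IsDiagonalMaximizer (X : H →L[ℂ] H) {k : ℕ} (x : Fin k → H) : Prop :=
  Orthonormal ℂ x ∧ ∀ y : Fin k → H, Orthonormal ℂ y →
    ∑ l, (⟪y l, X (y l)⟫_ℂ).re ≤ ∑ l, (⟪x l, X (x l)⟫_ℂ).re

/-- Replacing `x l` by the normalization of `x l + t w` keeps the system orthonormal and cannot
raise the sum; clearing the factor `1 + t ^ 2` leaves a quadratic in `t` that is nowhere positive.
-/
theorem IsDiagonalMaximizer.first_order {X : H →L[ℂ] H} (hX : IsSelfAdjoint X) {k : ℕ}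
    {x : Fin k → H} (hx : IsDiagonalMaximizer X x) (l : Fin k) {w : H} (hw : ‖w‖ = 1)
    (hwx : ∀ i, ⟪x i, w⟫_ℂ = 0) :
    (⟪x l, X w⟫_ℂ).re = 0 ∧ (⟪w, X w⟫_ℂ).re - (⟪x l, X (x l)⟫_ℂ).re ≤ 0 := by
  apply eq_zero_and_le_of_forall_quadratic
  intro t
  set s : ℝ := (√(1 + t ^ 2))⁻¹ with hs
  have hpos : 0 < 1 + t ^ 2 := by positivity
  have hs2 : s ^ 2 * (1 + t ^ 2) = 1 := by
    rw [hs, inv_pow, Real.sq_sqrt hpos.le, inv_mul_cancel₀ hpos.ne']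
  have hwxl : ⟪w, x l⟫_ℂ = 0 := by rw [← inner_conj_symm, hwx l, map_zero]
  set z : H := (s : ℂ) • (x l + (t : ℂ) • w) with hz
  have hz1 : ‖z‖ = 1 := by
    have h1 : ⟪x l + (t : ℂ) • w, x l + (t : ℂ) • w⟫_ℂ = ((1 + t ^ 2 : ℝ) : ℂ) := by
      have h3 : ⟪x l, x l⟫_ℂ = 1 := inner_self_eq_one_of_norm_eq_one (hx.1.1 l)
      have h4 : ⟪w, w⟫_ℂ = 1 := inner_self_eq_one_of_norm_eq_one hw
      rw [inner_add_left, inner_add_right, inner_add_right, inner_smul_left, inner_smul_right,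
        inner_smul_left, inner_smul_right, hwx l, hwxl, h3, h4, Complex.conj_ofReal]
      push_cast
      ring
    have h2 : ‖z‖ ^ 2 = 1 := by
      have : ((‖z‖ ^ 2 : ℝ) : ℂ) = ((s ^ 2 * (1 + t ^ 2) : ℝ) : ℂ) := by
        have h3 := inner_self_eq_norm_sq_to_K (𝕜 := ℂ) z
        rw [hz, inner_smul_left, inner_smul_right, h1, ← hz] at h3
        push_cast at h3 ⊢
        simp only [Complex.coe_algebraMap, Complex.conj_ofReal] at h3
        rw [← h3]; ring
      rw [hs2] at this
      exact_mod_cast this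
    nlinarith [norm_nonneg z]
  have hy := hx.2 _ (orthonormal_update hx.1 l hz1 (fun i hi => by
    rw [hz, inner_smul_right, inner_add_right, inner_smul_right, hx.1.2 hi, hwx i]; simp))
  have hsum : ∀ g : H → ℝ, ∑ i, g (Function.update x l z i) - ∑ i, g (x i) = g z - g (x l) := by
    intro g
    rw [← Finset.sum_sub_distrib, Finset.sum_eq_single l]
    · simp
    · intro i _ hi; simp [hi]
    · simp
  have hd := hsum (fun u => (⟪u, X u⟫_ℂ).re)
  have hsym : (⟪w, X (x l)⟫_ℂ).re = (⟪x l, X w⟫_ℂ).re := by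
    have : ⟪X w, x l⟫_ℂ = ⟪w, X (x l)⟫_ℂ := hX.isSymmetric w (x l)
    rw [← this, ← inner_conj_symm, Complex.conj_re]
  have hval : (⟪z, X z⟫_ℂ).re = s ^ 2 * ((⟪x l, X (x l)⟫_ℂ).re + 2 * t * (⟪x l, X w⟫_ℂ).re
      + t ^ 2 * (⟪w, X w⟫_ℂ).re) := by
    rw [hz]
    simp only [map_smul, map_add, inner_smul_left, inner_smul_right, inner_add_left,
      inner_add_right, Complex.conj_ofReal, Complex.re_ofReal_mul, Complex.add_re, hsym]
    ring
  have hle : (⟪z, X z⟫_ℂ).re ≤ (⟪x l, X (x l)⟫_ℂ).re := by linarith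
  rw [hval] at hle
  have h5 := mul_le_mul_of_nonneg_left hle hpos.le
  have h6 : (1 + t ^ 2) * (s ^ 2 * ((⟪x l, X (x l)⟫_ℂ).re + 2 * t * (⟪x l, X w⟫_ℂ).re
      + t ^ 2 * (⟪w, X w⟫_ℂ).re)) = ((⟪x l, X (x l)⟫_ℂ).re + 2 * t * (⟪x l, X w⟫_ℂ).re
      + t ^ 2 * (⟪w, X w⟫_ℂ).re) := by
    rw [← mul_assoc, mul_comm (1 + t ^ 2), hs2, one_mul]
  rw [h6] at h5
  linarith

/-- The sum depends on the span only, so `u` may be taken as a member of the system. The variations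
along `w` and `i w` control the real and the imaginary part of `⟪u, X w⟫`. -/
theorem IsDiagonalMaximizer.inner_eq_zero_and_le {X : H →L[ℂ] H} (hX : IsSelfAdjoint X) {k : ℕ}
    {x : Fin k → H} (hx : IsDiagonalMaximizer X x) {u w : H}
    (hu : u ∈ Submodule.span ℂ (Set.range x)) (hu1 : ‖u‖ = 1)
    (hw : w ∈ (Submodule.span ℂ (Set.range x))ᗮ) (hw1 : ‖w‖ = 1) :
    ⟪u, X w⟫_ℂ = 0 ∧ (⟪w, X w⟫_ℂ).re ≤ (⟪u, X u⟫_ℂ).re := by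
  obtain ⟨y, hy, hspan, l, rfl⟩ := exists_orthonormal_span_eq_mem hx.1 hu hu1
  have hymax : IsDiagonalMaximizer X y := by
    refine ⟨hy, fun z hz => (hx.2 z hz).trans_eq ?_⟩
    have := congrArg Complex.re (sum_inner_eq_of_span_eq hx.1 hy hspan X)
    simpa only [Complex.re_sum] using this
  rw [hspan] at hw
  have hyw : ∀ i, ⟪y i, w⟫_ℂ = 0 := fun i => hw _ (Submodule.subset_span ⟨i, rfl⟩)
  obtain ⟨h1, h2⟩ := hymax.first_order hX l hw1 hyw
  obtain ⟨h3, -⟩ := hymax.first_order hX l (w := Complex.I • w) (by simp [norm_smul, hw1])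
    (fun i => by rw [inner_smul_right, hyw i, mul_zero])
  rw [map_smul, inner_smul_right, Complex.I_mul_re, neg_eq_zero] at h3
  exact ⟨Complex.ext h1 h3, by linarith⟩

/-- The projection `P` splits `X` into its positive and its negative part. -/
structure IsPositiveSplitting (P X : H →L[ℂ] H) : Prop where
  idem : P * P = P
  commute : Commute P X
  nonneg : 0 ≤ P * X
  nonpos : (1 - P) * X ≤ 0

theorem IsDiagonalMaximizer.inner_eq_zero_of_mem_orthogonal {X : H →L[ℂ] H} (hX : IsSelfAdjoint X) {k : ℕ}
    {x : Fin k → H} (hx : IsDiagonalMaximizer X x) {u w : H}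
    (hu : u ∈ Submodule.span ℂ (Set.range x))
    (hw : w ∈ (Submodule.span ℂ (Set.range x))ᗮ) : ⟪u, X w⟫_ℂ = 0 := by
  by_cases hu0 : u = 0
  · simp [hu0]
  by_cases hw0 : w = 0
  · simp [hw0]
  obtain ⟨u', hu', hu1, hue⟩ := exists_unit_smul hu hu0
  obtain ⟨w', hw', hw1, hwe⟩ := exists_unit_smul hw hw0
  rw [hue, hwe, map_smul, inner_smul_left, inner_smul_right,
    (hx.inner_eq_zero_and_le hX hu' hu1 hw' hw1).1]
  simp

/-- If the compression of `X` to the orthogonal complement of a space of dimension at most `k`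
vanishes, then the span of a maximizing orthonormal `k`-system carries the positive part of `X`. -/
theorem IsDiagonalMaximizer.isPositiveSplitting (hH : ¬ FiniteDimensional ℂ H)
    {X : H →L[ℂ] H} (hX : IsSelfAdjoint X) {k : ℕ} {x : Fin k → H}
    (hx : IsDiagonalMaximizer X x) {S : Submodule ℂ H} [FiniteDimensional ℂ S]
    (hS : Module.finrank ℂ S ≤ k) (hXS : ∀ u ∈ Sᗮ, (⟪u, X u⟫_ℂ).re = 0)
    [(Submodule.span ℂ (Set.range x)).HasOrthogonalProjection] :
    IsPositiveSplitting (Submodule.span ℂ (Set.range x)).starProjection X := by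
  have hfin : FiniteDimensional ℂ (Submodule.span ℂ (Set.range x)) :=
    FiniteDimensional.span_of_finite ℂ (Set.finite_range x)
  have hcard : Module.finrank ℂ (Submodule.span ℂ (Set.range x)) = k := by
    simpa using finrank_span_eq_card hx.1.linearIndependent
  have hzero := fun {u w : H} => hx.inner_eq_zero_of_mem_orthogonal hX (u := u) (w := w)
  have hone := fun {u w : H} => hx.inner_eq_zero_and_le hX (u := u) (w := w)
  generalize Submodule.span ℂ (Set.range x) = M at *
  have hsym : ∀ u v, ⟪X u, v⟫_ℂ = ⟪u, X v⟫_ℂ := hX.isSymmetric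
  have hM' : ∀ w ∈ Mᗮ, X w ∈ Mᗮ := fun w hw u hu => hzero hu hw
  have hM : ∀ u ∈ M, X u ∈ M := by
    intro u hu
    rw [← Submodule.orthogonal_orthogonal M]
    intro w hw
    rw [← hsym, ← inner_conj_symm, hzero hu hw, map_zero]
  have hpos : ∀ u ∈ M, 0 ≤ (⟪u, X u⟫_ℂ).re := by
    intro u hu
    by_cases hu0 : u = 0
    · simp [hu0]
    -- Infinite dimension supplies a competitor outside both `M` and `S`, at which the form is zero.
    obtain ⟨w, hw, hw1⟩ := exists_unit_mem_orthogonal hH (M ⊔ S)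
    obtain ⟨v, hv, hv1, huv⟩ := exists_unit_smul hu hu0
    rw [huv, re_inner_smul_self]
    have h1 := (hone hv hv1 (Submodule.orthogonal_le le_sup_left hw) hw1).2
    rw [hXS w (Submodule.orthogonal_le le_sup_right hw)] at h1
    positivity
  have hneg : ∀ w ∈ Mᗮ, (⟪w, X w⟫_ℂ).re ≤ 0 := by
    intro w hw
    by_cases hw0 : w = 0
    · simp [hw0]
    obtain ⟨v, hv, hv1, hwv⟩ := exists_unit_smul hw hw0
    rw [hwv, re_inner_smul_self]
    suffices (⟪v, X v⟫_ℂ).re ≤ 0 from mul_nonpos_of_nonneg_of_nonpos (by positivity) this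
    by_contra! hcon
    -- Here `k ≥ dim S` enters: `M ⊕ ℂ v` has dimension `k + 1`, so some nonzero `u + c v` lies in
    -- `Sᗮ`, where the form vanishes. The form is the sum of two nonnegative terms there, so `c =
    -- 0`; but on unit vectors of `M` the form is at least its positive value at `v`.
    let T : (M × ℂ) →ₗ[ℂ] S := S.orthogonalProjectionOnto.toLinearMap ∘ₗ
      (M.subtype.coprod (LinearMap.toSpanSingleton ℂ H v))
    have hT : T.ker ≠ ⊥ := LinearMap.ker_ne_bot_of_finrank_lt (by
      rw [Module.finrank_prod, hcard, Module.finrank_self]; omega)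
    obtain ⟨⟨⟨u, hu⟩, c⟩, hmem, hne⟩ := Submodule.exists_mem_ne_zero_of_ne_bot hT
    have hSo : u + c • v ∈ Sᗮ := by
      have : S.orthogonalProjectionOnto (u + c • v) = 0 := by simpa [T] using hmem
      rwa [Submodule.orthogonalProjectionOnto_eq_zero_iff] at this
    have h0 := hXS _ hSo
    have hvu : ⟪v, X u⟫_ℂ = 0 := by
      rw [← hsym, ← inner_conj_symm, hzero hu hv, map_zero]
    have hexp : (⟪u + c • v, X (u + c • v)⟫_ℂ).re
        = (⟪u, X u⟫_ℂ).re + (⟪c • v, X (c • v)⟫_ℂ).re := by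
      simp only [map_add, map_smul, inner_add_left, inner_add_right, inner_smul_left,
        inner_smul_right, hzero hu hv, hvu, Complex.add_re]
      simp
    rw [hexp, re_inner_smul_self] at h0
    have hc0 := hpos u hu
    have hc : c = 0 := by
      by_contra hc
      have : 0 < ‖c‖ ^ 2 := by positivity
      nlinarith
    by_cases hu0 : u = 0
    · exact hne (by simp [hu0, hc])
    obtain ⟨u', hu', hu1, hue⟩ := exists_unit_smul hu hu0
    have h2 := (hone hu' hu1 hv hv1).2
    rw [hue, re_inner_smul_self, hc] at h0
    have h3 : 0 < ‖((‖u‖ : ℝ) : ℂ)‖ ^ 2 := by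
      have := norm_pos_iff.mpr hu0
      simp only [Complex.norm_real, norm_norm]; positivity
    have h4 : 0 < ‖((‖u‖ : ℝ) : ℂ)‖ ^ 2 * (⟪u', X u'⟫_ℂ).re := mul_pos h3 (by linarith)
    norm_num at h0 h4
    rcases h0 with h0 | h0
    · exact hu0 h0
    · linarith
  set P := M.starProjection with hP
  have hPM : ∀ z, P z ∈ M := fun z => Submodule.starProjection_apply_mem M z
  have hPM' : ∀ z, z - P z ∈ Mᗮ := fun z => Submodule.sub_starProjection_mem_orthogonal z
  have hcomm : ∀ z, P (X z) = X (P z) := by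
    intro z
    refine Submodule.eq_starProjection_of_mem_orthogonal (hM _ (hPM z)) ?_
    rw [← map_sub]
    exact hM' _ (hPM' z)
  have hc : Commute P X := by
    ext z
    exact hcomm z
  have hPsa : IsSelfAdjoint P := isSelfAdjoint_starProjection M
  have hsa : IsSelfAdjoint (P * X) := (hPsa.commute_iff hX).mp hc
  refine ⟨isStarProjection_starProjection.isIdempotentElem, hc, ?_, ?_⟩
  · rw [ContinuousLinearMap.nonneg_iff_isPositive]
    refine ⟨hsa.isSymmetric, fun z => ?_⟩
    have h1 : ⟪X (P z), z⟫_ℂ = ⟪P z, X (P z)⟫_ℂ := by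
      rw [← hsym (P z) (P z), ← sub_eq_zero, ← inner_sub_right]
      exact hPM' z _ (hM _ (hPM z))
    have h2 : 0 ≤ (⟪P (X z), z⟫_ℂ).re := by
      rw [hcomm, h1]; exact hpos _ (hPM z)
    exact h2
  · rw [ContinuousLinearMap.le_def]
    refine ⟨?_, fun z => ?_⟩
    · have : IsSelfAdjoint (0 - (1 - P) * X) := by
        rw [sub_mul, one_mul]
        exact (IsSelfAdjoint.zero _).sub (hX.sub hsa)
      exact this.isSymmetric
    have h1 : ⟪X (z - P z), z⟫_ℂ = ⟪z - P z, X (z - P z)⟫_ℂ := by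
      rw [← hsym (z - P z) (z - P z), ← sub_eq_zero, ← inner_sub_right, sub_sub_cancel,
        ← inner_conj_symm, hM' _ (hPM' z) _ (hPM z), map_zero]
    have h2 : (⟪X (z - P z), z⟫_ℂ).re ≤ 0 := by
      rw [h1]; exact hneg _ (hPM' z)
    have h3 : 0 ≤ (⟪(0 - (1 - P) * X) z, z⟫_ℂ).re := by
      have : (0 - (1 - P) * X) z = -(X (z - P z)) := by
        simp [sub_mul, hcomm]
      rw [this, inner_neg_left, Complex.neg_re]
      linarith
    exact h3
end

/-! ### Positive splittings, commutators and hermitian combinations. -/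

section
variable {H : Type*} [NormedAddCommGroup H] [InnerProductSpace ℂ H] [CompleteSpace H]

/-- `X` is the difference of the nonnegative operators `PX` and `-(1 - P)X`, whose product is zero;
such a decomposition is unique. Hence `PX` does not depend on `P`. -/
theorem IsPositiveSplitting.mul_eq_posPart {P X : H →L[ℂ] H} (h : IsPositiveSplitting P X) :
    P * X = X⁺ := by
  have h1 : X = P * X - (-((1 - P) * X)) := by noncomm_ring
  have h2 : P * X * (-((1 - P) * X)) = 0 := by
    rw [h.commute.eq, mul_neg, mul_assoc, ← mul_assoc P, mul_sub, mul_one, h.idem, sub_self,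
      zero_mul, mul_zero, neg_zero]
  exact (CFC.posPart_negPart_unique h1 h2 h.nonneg (neg_nonneg.mpr h.nonpos)).1.symm

theorem IsPositiveSplitting.one_sub_neg {P X : H →L[ℂ] H} (h : IsPositiveSplitting P X) :
    IsPositiveSplitting (1 - P) (-X) where
  idem := by
    have := h.idem
    simp [mul_sub, sub_mul, this]
  commute := ((Commute.one_left X).sub_left h.commute).neg_right
  nonneg := by
    rw [mul_neg]; exact neg_nonneg.mpr h.nonpos
  nonpos := by
    rw [sub_sub_cancel, mul_neg]; exact neg_nonpos.mpr h.nonneg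

/-- Two operators commute if every operator in the plane that they span is split into its positive
and negative part by one of finitely many projections commuting with both. -/
theorem commute_of_finite_positiveSplittings {κ : Type*} {F : Set κ} (hF : F.Finite)
    (P : κ → H →L[ℂ] H) (C : κ → Set ℝ) (hC : ∀ v ∈ F, IsClosed (C v))
    (hcover : ∀ t, ∃ v ∈ F, t ∈ C v) {X Y : H →L[ℂ] H}
    (hX : ∀ v ∈ F, Commute (P v) X) (hY : ∀ v ∈ F, Commute (P v) Y)
    (hsplit : ∀ v ∈ F, ∀ t ∈ C v, IsPositiveSplitting (P v) (Real.cos t • X + Real.sin t • Y)) :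
    Commute X Y := by
  set K := X * Y - Y * X with hK
  -- With `Z = aX + bY`, the difference `Q - R` annihilates `Z` and commutes with `X` and `Y`, so it
  -- annihilates `[Z, Y] = aK` and `[X, Z] = bK`; `a` and `b` are not both zero.
  have hZX : ∀ Q R : H →L[ℂ] H, Commute Q X → Commute R X → Commute Q Y → Commute R Y →
      ∀ a b : ℝ, a ^ 2 + b ^ 2 = 1 → Q * (a • X + b • Y) = R * (a • X + b • Y) →
      Q * K = R * K := by
    intro Q R hQX hRX hQY hRY a b hab h
    have hD : (Q - R) * (a • X + b • Y) = 0 := by rw [sub_mul, h, sub_self]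
    have hDX : (Q - R) * X = X * (Q - R) := (hQX.sub_left hRX).eq
    have hDY : (Q - R) * Y = Y * (Q - R) := (hQY.sub_left hRY).eq
    have e1 : a • ((Q - R) * K) = 0 := by
      have : a • K = (a • X + b • Y) * Y - Y * (a • X + b • Y) := by
        simp only [hK, add_mul, mul_add, smul_mul_assoc, mul_smul_comm, smul_sub]; abel
      rw [← mul_smul_comm, this, mul_sub, ← mul_assoc, hD, ← mul_assoc, hDY, mul_assoc, hD]
      simp
    have e2 : b • ((Q - R) * K) = 0 := by
      have : b • K = X * (a • X + b • Y) - (a • X + b • Y) * X := by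
        simp only [hK, add_mul, mul_add, smul_mul_assoc, mul_smul_comm, smul_sub]; abel
      rw [← mul_smul_comm, this, mul_sub, ← mul_assoc, hDX, mul_assoc, hD, ← mul_assoc, hD]
      simp
    have : (Q - R) * K = 0 := by
      calc (Q - R) * K = (a ^ 2 + b ^ 2) • ((Q - R) * K) := by rw [hab, one_smul]
        _ = a • (a • ((Q - R) * K)) + b • (b • ((Q - R) * K)) := by
          rw [add_smul, smul_smul, smul_smul, pow_two, pow_two]
        _ = 0 := by rw [e1, e2]; simp
    rwa [sub_mul, sub_eq_zero] at this
  obtain ⟨p, hp, h0⟩ := hcover 0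
  have hclosed : ∀ s : Set κ, s ⊆ F → IsClosed (⋃ v ∈ s, C v) := fun s hs =>
    (hF.subset hs).isClosed_biUnion fun v hv => hC v (hs hv)
  let G : Set κ := {v ∈ F | P v * K = P p * K}
  let G' : Set κ := {v ∈ F | P v * K ≠ P p * K}
  -- The parameter line is covered by two closed sets, disjoint because projections that share a
  -- parameter have the same product with `K`. Connectedness leaves only the first.
  have hcompl : (⋃ v ∈ G, C v) = (⋃ v ∈ G', C v)ᶜ := by
    ext t
    simp only [Set.mem_iUnion, Set.mem_compl_iff, not_exists, exists_prop, not_and]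
    constructor
    · rintro ⟨v, hv, ht⟩ w hw htw
      refine hw.2 (Eq.trans ?_ hv.2)
      refine hZX _ _ (hX w hw.1) (hX v hv.1) (hY w hw.1) (hY v hv.1) _ _
        (Real.cos_sq_add_sin_sq t) ?_
      rw [(hsplit w hw.1 t htw).mul_eq_posPart, (hsplit v hv.1 t ht).mul_eq_posPart]
    · intro h
      obtain ⟨v, hv, ht⟩ := hcover t
      refine ⟨v, ⟨hv, ?_⟩, ht⟩
      by_contra hne
      exact h v ⟨hv, hne⟩ ht
  have hclopen : IsClopen (⋃ v ∈ G, C v) := by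
    refine ⟨hclosed G fun v hv => hv.1, ?_⟩
    rw [hcompl]
    exact (hclosed G' fun v hv => hv.1).isOpen_compl
  have huniv := hclopen.eq_univ ⟨0, Set.mem_biUnion (show p ∈ G from ⟨hp, rfl⟩) h0⟩
  -- At `t = π` the operator is `-X`, so `1 - P q` splits `X` as `P p` does. This gives `K = 2 (P p)
  -- K`, and one more multiplication by the idempotent `P p` gives `(P p) K = 0`.
  have hpi : Real.pi ∈ ⋃ v ∈ G, C v := huniv ▸ Set.mem_univ _
  simp only [Set.mem_iUnion, exists_prop] at hpi
  obtain ⟨q, ⟨hq, hqp⟩, hqt⟩ := hpi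
  have s0 := hsplit p hp 0 h0
  have s1 := (hsplit q hq _ hqt).one_sub_neg
  simp only [Real.cos_zero, Real.sin_zero, one_smul, zero_smul, add_zero, Real.cos_pi,
    Real.sin_pi, neg_smul, neg_neg] at s0 s1
  have h1 : P p * K = (1 - P q) * K := by
    refine hZX _ _ (hX p hp) ((Commute.one_left X).sub_left (hX q hq)) (hY p hp)
      ((Commute.one_left Y).sub_left (hY q hq)) 1 0 (by norm_num) ?_
    simp only [one_smul, zero_smul, add_zero]
    rw [s0.mul_eq_posPart, s1.mul_eq_posPart]
  rw [sub_mul, one_mul, hqp] at h1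
  have h2 : K = P p * K + P p * K := by rw [eq_sub_iff_add_eq] at h1; exact h1.symm
  have h3 : P p * K = P p * K + P p * K := by
    conv_lhs => rw [h2, mul_add, ← mul_assoc, s0.idem]
  have h4 : P p * K = 0 := by simpa using h3
  rw [h4, add_zero] at h2
  exact sub_eq_zero.mp (hK ▸ h2)

/-- The hermitian part of the linear combination `∑ j, c j • A j`. -/
noncomputable def hermitianCombination {m : ℕ} (A : Fin m → H →L[ℂ] H) (c : Fin m → ℂ) :
    H →L[ℂ] H :=
  ((realPart (∑ j, c j • A j) : selfAdjoint (H →L[ℂ] H)) : H →L[ℂ] H)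

theorem isSelfAdjoint_hermitianCombination {m : ℕ} (A : Fin m → H →L[ℂ] H) (c : Fin m → ℂ) :
    IsSelfAdjoint (hermitianCombination A c) := (realPart (∑ j, c j • A j)).2

theorem hermitianCombination_add_smul {m : ℕ} (A : Fin m → H →L[ℂ] H) (c d : Fin m → ℂ)
    (s t : ℝ) : hermitianCombination A (s • c + t • d)
      = s • hermitianCombination A c + t • hermitianCombination A d := by
  have : ∑ j, (s • c + t • d) j • A j = s • (∑ j, c j • A j) + t • ∑ j, d j • A j := by
    simp only [Pi.add_apply, Pi.smul_apply, add_smul, Finset.sum_add_distrib, Finset.smul_sum,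
      smul_assoc]
  rw [hermitianCombination, this, map_add, map_smul, map_smul]
  rfl

theorem re_inner_hermitianCombination {m : ℕ} (A : Fin m → H →L[ℂ] H) (c : Fin m → ℂ) (u : H) :
    (⟪u, hermitianCombination A c u⟫_ℂ).re = (∑ j, c j * ⟪u, A j u⟫_ℂ).re := by
  have hB : ⟪u, (∑ j, c j • A j) u⟫_ℂ = ∑ j, c j * ⟪u, A j u⟫_ℂ := by
    simp
  rw [← hB, hermitianCombination, realPart_apply_coe]
  generalize ∑ j, c j • A j = B
  have : ⟪u, (star B) u⟫_ℂ = (starRingEnd ℂ) ⟪u, B u⟫_ℂ := by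
    rw [ContinuousLinearMap.star_eq_adjoint, ContinuousLinearMap.adjoint_inner_right,
      inner_conj_symm]
  rw [smul_apply, add_apply, ← Complex.coe_smul,
    inner_smul_right, inner_add_right, this, Complex.re_ofReal_mul, Complex.add_re,
    Complex.conj_re]
  ring

/-- The coefficients `1` and `-i` in position `j` produce the real and imaginary parts of `A j`,
from which `A j` and its adjoint are assembled. -/
theorem isCommutingNormalFamily_of_commute_hermitianCombination {m : ℕ} {A : Fin m → H →L[ℂ] H}
    (h : ∀ c d, Commute (hermitianCombination A c) (hermitianCombination A d)) :
    IsCommutingNormalFamily A := by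
  have hre : ∀ j, hermitianCombination A (Pi.single j 1) = (ℜ (A j) : H →L[ℂ] H) := by
    intro j
    rw [hermitianCombination, Finset.sum_eq_single j] <;> simp +contextual
  have him : ∀ j, hermitianCombination A (Pi.single j (-Complex.I)) = (ℑ (A j) : H →L[ℂ] H) := by
    intro j
    rw [hermitianCombination, Finset.sum_eq_single j]
    · rw [Pi.single_eq_same, neg_smul, map_neg, realPart_I_smul, neg_neg]
    · simp +contextual
    · simp
  have hall : ∀ i j, Commute (A i) (A j) ∧ Commute (star (A i)) (A j) := by
    intro i j
    have h1 := h (Pi.single i 1) (Pi.single j 1)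
    have h2 := h (Pi.single i 1) (Pi.single j (-Complex.I))
    have h3 := h (Pi.single i (-Complex.I)) (Pi.single j 1)
    have h4 := h (Pi.single i (-Complex.I)) (Pi.single j (-Complex.I))
    rw [hre, hre] at h1
    rw [hre, him] at h2
    rw [him, hre] at h3
    rw [him, him] at h4
    have hj := realPart_add_I_smul_imaginaryPart (A j)
    have hi := realPart_add_I_smul_imaginaryPart (A i)
    have hi' : star (A i) = ℜ (A i) - Complex.I • (ℑ (A i) : H →L[ℂ] H) := by
      conv_lhs => rw [← hi]
      simp [sub_eq_add_neg]
    constructor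
    · rw [← hj, ← hi]
      exact ((h1.add_right (h2.smul_right _))).add_left
        ((h3.smul_left _).add_right ((h4.smul_left _).smul_right _))
    · rw [hi', ← hj]
      exact ((h1.add_right (h2.smul_right _))).sub_left
        ((h3.smul_left _).add_right ((h4.smul_left _).smul_right _))
  exact ⟨fun j => ⟨(hall j j).2⟩, fun i j => (hall i j).1⟩

end

theorem exists_re_sum_mul_eq {m : ℕ} (f : (Fin m → ℂ) →ₗ[ℝ] ℝ) :
    ∃ c : Fin m → ℂ, ∀ v, f v = (∑ j, c j * v j).re := by
  refine ⟨fun j => ⟨f (Pi.single j 1), - f (Pi.single j Complex.I)⟩, fun v => ?_⟩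
  have hv : v = ∑ j, ((v j).re • (Pi.single j 1 : Fin m → ℂ)
      + (v j).im • (Pi.single j Complex.I : Fin m → ℂ)) := by
    have : ∀ j, ((v j).re • (Pi.single j 1 : Fin m → ℂ)
      + (v j).im • (Pi.single j Complex.I : Fin m → ℂ)) = Pi.single j (v j) := by
      intro j
      rw [← Pi.single_smul, ← Pi.single_smul, ← Pi.single_add]
      congr 1
      simp
    simp_rw [this]
    exact (Finset.univ_sum_single v).symm
  conv_lhs => rw [hv]
  rw [map_sum, Complex.re_sum]
  refine Finset.sum_congr rfl fun j _ => ?_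
  rw [map_add, map_smul, map_smul]
  simp
  ring

/-! ### From a polyhedral convex hull to commuting normality. -/

section
variable {H : Type*} [NormedAddCommGroup H] [InnerProductSpace ℂ H] [CompleteSpace H]

theorem isCommutingNormalFamily_of_isPolyhedral_convexHull (hH : ¬ FiniteDimensional ℂ H)
    {m : ℕ} (A : Fin m → H →L[ℂ] H)
    (hA : ∀ j, FiniteDimensional ℂ (LinearMap.range (A j : H →ₗ[ℂ] H))) {k : ℕ}
    (hk : rangeSumDim A ≤ k) (hpoly : IsPolyhedral (convexHull ℝ (kNumericalRange k A))) :
    IsCommutingNormalFamily A := by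
  obtain ⟨F₀, hF₀, hF₀W⟩ := hpoly
  set W := kNumericalRange k A with hW
  set F := Set.extremePoints ℝ (convexHull ℝ W) with hFdef
  have hF : F.Finite := hF₀.subset (by rw [hFdef, hF₀W]; exact extremePoints_convexHull_subset)
  have hconvF : convexHull ℝ W = convexHull ℝ F := by
    have hc : IsCompact (convexHull ℝ W) := by rw [hF₀W]; exact hF₀.isCompact_convexHull (𝕜 := ℝ)
    rw [← closure_convexHull_extremePoints hc (convex_convexHull ℝ W)]
    exact (hF.isClosed_convexHull (𝕜 := ℝ)).closure_eq
  have hFW : F ⊆ W := extremePoints_convexHull_subset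
  obtain ⟨x, hx⟩ : ∃ x : (Fin m → ℂ) → Fin k → H, ∀ v ∈ F, Orthonormal ℂ (x v) ∧
      ∀ j, v j = ∑ l, ⟪x v l, A j (x v l)⟫_ℂ := by
    have : ∀ v, ∃ y : Fin k → H, v ∈ F → Orthonormal ℂ y ∧
        ∀ j, v j = ∑ l, ⟪y l, A j (y l)⟫_ℂ := by
      intro v
      by_cases hv : v ∈ F
      · obtain ⟨y, hy⟩ := hFW hv
        exact ⟨y, fun _ => hy⟩
      · exact ⟨0, fun h => absurd h hv⟩
    choose x hx using this
    exact ⟨x, hx⟩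
  have hval : ∀ (y : Fin k → H) (v : Fin m → ℂ), (∀ j, v j = ∑ l, ⟪y l, A j (y l)⟫_ℂ) →
      ∀ c, ∑ l, (⟪y l, hermitianCombination A c (y l)⟫_ℂ).re = (∑ j, c j * v j).re := by
    intro y v hv c
    simp_rw [re_inner_hermitianCombination, hv, ← Complex.re_sum, Finset.mul_sum]
    rw [Finset.sum_comm]
  -- A bound for a functional at the vertices holds on all of `W`; a maximal vertex thus gives a
  -- maximizing orthonormal system.
  have hle : ∀ (c : Fin m → ℂ) (M : ℝ), (∀ w ∈ F, (∑ j, c j * w j).re ≤ M) →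
      ∀ w ∈ W, (∑ j, c j * w j).re ≤ M := by
    intro c M h w hw
    have hcx : Convex ℝ {w : Fin m → ℂ | (∑ j, c j * w j).re ≤ M} := by
      refine convex_halfSpace_le ⟨fun a b => ?_, fun a b => ?_⟩ M
      · simp [mul_add, Finset.sum_add_distrib]
      · simp [Finset.mul_sum, mul_left_comm, mul_sub]
    have : convexHull ℝ F ⊆ {w : Fin m → ℂ | (∑ j, c j * w j).re ≤ M} := convexHull_min h hcx
    exact this (hconvF ▸ subset_convexHull ℝ W hw)
  set S : Submodule ℂ H := ⨆ j, LinearMap.range (A j : H →ₗ[ℂ] H) with hS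
  have hSfin : FiniteDimensional ℂ S := Submodule.finiteDimensional_iSup _
  have hspan : ∀ v, FiniteDimensional ℂ (Submodule.span ℂ (Set.range (x v))) := fun v =>
    FiniteDimensional.span_of_finite ℂ (Set.finite_range (x v))
  let P : (Fin m → ℂ) → H →L[ℂ] H := fun v =>
    (Submodule.span ℂ (Set.range (x v))).starProjection
  have hsplit : ∀ v ∈ F, ∀ c : Fin m → ℂ,
      (∀ w ∈ F, (∑ j, c j * w j).re ≤ (∑ j, c j * v j).re) →
      IsPositiveSplitting (P v) (hermitianCombination A c) := by
    intro v hv c hc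
    have hmax : IsDiagonalMaximizer (hermitianCombination A c) (x v) := by
      refine ⟨(hx v hv).1, fun y hy => ?_⟩
      rw [hval (x v) v (hx v hv).2 c, hval y _ (fun j => rfl) c]
      exact hle c _ hc _ ⟨y, hy, fun j => rfl⟩
    refine hmax.isPositiveSplitting hH (isSelfAdjoint_hermitianCombination A c) (S := S) hk ?_
    intro u hu
    rw [re_inner_hermitianCombination]
    have : ∀ j, ⟪u, A j u⟫_ℂ = 0 := fun j => by
      rw [← inner_conj_symm, hu (A j u) (Submodule.mem_iSup_of_mem j ⟨u, rfl⟩), map_zero]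
    simp [this]
  have hcomm : ∀ v ∈ F, ∀ d, Commute (P v) (hermitianCombination A d) := by
    intro v hv d
    -- Separating the vertex `v` from the hull of the others gives `c` at which `v` is the strict
    -- maximum. Finitely many strict inequalities survive for `c + t d` with `t` small, so `P v`
    -- commutes with the combinations at `c` and at some `c + t d`, `t ≠ 0`, hence with that at `d`.
    have hnot : v ∉ convexHull ℝ (F \ {v}) := by
      intro hmem
      have h1 := ((convex_convexHull ℝ W).mem_extremePoints_iff_mem_sdiff_convexHull_sdiff.mp hv).2
      refine h1 (convexHull_mono ?_ hmem)
      exact Set.sdiff_subset_sdiff_left (hFW.trans (subset_convexHull ℝ W))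
    have hF' : (F \ {v}).Finite := hF.sdiff
    obtain ⟨f, u, hfu, huv⟩ := geometric_hahn_banach_closed_point
      (convex_convexHull ℝ (F \ {v})) (hF'.isClosed_convexHull (𝕜 := ℝ)) hnot
    obtain ⟨c, hc⟩ := exists_re_sum_mul_eq f.toLinearMap
    obtain ⟨g, hg⟩ : ∃ g : ℝ → Fin m → ℂ, ∀ t, g t = (1 : ℝ) • c + t • d := ⟨_, fun _ => rfl⟩
    have hlt : ∀ w ∈ F \ {v}, ∀ᶠ t in nhds (0 : ℝ),
        (∑ j, g t j * w j).re < (∑ j, g t j * v j).re := by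
      intro w hw
      have hcont : ∀ z : Fin m → ℂ, Continuous fun t => (∑ j, g t j * z j).re := by
        intro z
        simp only [hg, Pi.add_apply, Pi.smul_apply]
        fun_prop
      refine (hcont w).continuousAt.eventually_lt (hcont v).continuousAt ?_
      have := hfu w (subset_convexHull ℝ _ hw)
      simp only [hg, zero_smul, one_smul, add_zero]
      rw [← hc, ← hc]
      exact this.trans huv
    have hev : ∀ᶠ t in nhds (0 : ℝ), ∀ w ∈ F \ {v},
        (∑ j, g t j * w j).re < (∑ j, g t j * v j).re := (hF'.eventually_all).mpr hlt
    have hgood : ∀ᶠ t in nhds (0 : ℝ), Commute (P v) (hermitianCombination A (g t)) := by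
      filter_upwards [hev] with t ht
      refine (hsplit v hv _ fun w hw => ?_).commute
      by_cases hwv : w = v
      · rw [hwv]
      · exact (ht w ⟨hw, hwv⟩).le
    have h0 := hgood.self_of_nhds
    obtain ⟨t, ht, ht0⟩ := ((hgood.filter_mono nhdsWithin_le_nhds).and
      (self_mem_nhdsWithin : {0}ᶜ ∈ nhdsWithin (0 : ℝ) {0}ᶜ)).exists
    rw [hg, hermitianCombination_add_smul] at h0 ht
    rw [zero_smul, add_zero, one_smul] at h0
    rw [one_smul] at ht
    have h2 := ht.sub_right h0
    rw [add_sub_cancel_left] at h2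
    have h3 := h2.smul_right (t⁻¹)
    rwa [smul_smul, inv_mul_cancel₀ ht0, one_smul] at h3
  have hFne : F.Nonempty := by
    by_contra h
    rw [Set.not_nonempty_iff_eq_empty] at h
    rw [h, convexHull_empty, convexHull_eq_empty] at hconvF
    obtain ⟨y, hy⟩ : ∃ y : Fin k → H, Orthonormal ℂ y := by
      obtain ⟨w, b, -⟩ := exists_hilbertBasis ℂ H
      have : Infinite w := by
        by_contra hfin
        rw [not_infinite_iff_finite] at hfin
        have := Fintype.ofFinite w
        exact hH (Module.Basis.finiteDimensional_of_finite b.toOrthonormalBasis.toBasis)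
      obtain ⟨i⟩ : Nonempty (Fin k ↪ w) := ⟨(Fin.valEmbedding).trans (Infinite.natEmbedding w)⟩
      exact ⟨b ∘ i, b.orthonormal.comp _ i.injective⟩
    have : (fun j => ∑ l, ⟪y l, A j (y l)⟫_ℂ) ∈ W := ⟨y, hy, fun j => rfl⟩
    rw [hconvF] at this
    exact this
  refine isCommutingNormalFamily_of_commute_hermitianCombination fun c d => ?_
  obtain ⟨g, hg⟩ : ∃ g : ℝ → Fin m → ℂ, ∀ t, g t = Real.cos t • c + Real.sin t • d :=
    ⟨_, fun _ => rfl⟩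
  refine commute_of_finite_positiveSplittings hF P
    (fun v => {t | ∀ w ∈ F, (∑ j, g t j * w j).re ≤ (∑ j, g t j * v j).re}) ?_ ?_
    (fun v hv => hcomm v hv c) (fun v hv => hcomm v hv d) ?_
  · intro v _
    have hcont : ∀ z : Fin m → ℂ, Continuous fun t => (∑ j, g t j * z j).re := by
      intro z
      simp only [hg, Pi.add_apply, Pi.smul_apply]
      fun_prop
    simp only [Set.ofPred_forall]
    exact isClosed_biInter fun w _ => isClosed_le (hcont w) (hcont v)
  · intro t
    exact hF.exists_maximalFor (fun w => (∑ j, g t j * w j).re) F hFne |>.imp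
      fun v hv => ⟨hv.1, fun w hw => (le_total _ _).elim id (hv.2 hw)⟩
  · intro v hv t ht
    rw [← hermitianCombination_add_smul, ← hg]
    exact hsplit v hv _ ht
end

/-! ### Equipotent Hilbert bases and joint diagonalization. -/

section
variable {H : Type*} [NormedAddCommGroup H] [InnerProductSpace ℂ H]

theorem HilbertBasis.infinite_of_not_finiteDimensional (hH : ¬ FiniteDimensional ℂ H) {ι : Type*}
    (b : HilbertBasis ι ℂ H) : Infinite ι := by
  by_contra hfin
  rw [not_infinite_iff_finite] at hfin
  have := Fintype.ofFinite ι
  exact hH (Module.Basis.finiteDimensional_of_finite b.toOrthonormalBasis.toBasis)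

/-- Each `b' k` has a nonzero coefficient along some `b i`, and each `b i` is met by countably many
`b' k` only. So `κ` embeds into `ι × ℕ`, which is equipotent with the infinite `ι`. -/
theorem HilbertBasis.nonempty_embedding {ι κ : Type*} [Infinite ι] (b : HilbertBasis ι ℂ H)
    (b' : HilbertBasis κ ℂ H) : Nonempty (κ ↪ ι) := by
  have h1 : ∀ k, ∃ i, ⟪b' k, b i⟫_ℂ ≠ 0 := by
    intro k
    by_contra! h
    have h2 := b.hasSum_inner_mul_inner (b' k) (b' k)
    simp only [h, zero_mul] at h2
    have h3 := h2.unique hasSum_zero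
    rw [inner_self_eq_zero] at h3
    exact b'.orthonormal.ne_zero k h3
  choose i hi using h1
  have h2 : ∀ j, {k | ⟪b' k, b j⟫_ℂ ≠ 0}.Countable := by
    intro j
    refine (b'.summable_inner_mul_inner (b j) (b j)).countable_support.mono fun k hk => ?_
    simp only [Function.mem_support, ne_eq, mul_eq_zero, not_or]
    refine ⟨fun h => hk ?_, hk⟩
    rw [← inner_conj_symm, h, map_zero]
  have h3 : ∀ j, ∃ g : κ → ℕ, Set.InjOn g {k | ⟪b' k, b j⟫_ℂ ≠ 0} := fun j =>
    (Set.countable_iff_exists_injOn).mp (h2 j)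
  choose g hg using h3
  obtain ⟨σ⟩ : Nonempty (ι × ℕ ≃ ι) := by
    rw [← Cardinal.eq]
    simp
  refine ⟨⟨fun k => σ (i k, g (i k) k), fun k k' hkk => ?_⟩⟩
  have h4 := σ.injective hkk
  simp only [Prod.mk.injEq] at h4
  refine hg (i k) (hi k) ?_ (h4.2.trans (by rw [h4.1]))
  rw [h4.1]
  exact hi k'

/-- Any two Hilbert bases of an infinite-dimensional Hilbert space are equipotent. -/
theorem HilbertBasis.nonempty_equiv (hH : ¬ FiniteDimensional ℂ H) {ι κ : Type*}
    (b : HilbertBasis ι ℂ H) (b' : HilbertBasis κ ℂ H) : Nonempty (ι ≃ κ) := by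
  have := b.infinite_of_not_finiteDimensional hH
  have := b'.infinite_of_not_finiteDimensional hH
  obtain ⟨f⟩ := b.nonempty_embedding b'
  obtain ⟨g⟩ := b'.nonempty_embedding b
  exact Function.Embedding.antisymm g f

universe u in
theorem exists_orthonormal_joint_eigenvectors {E : Type*} [NormedAddCommGroup E]
    [InnerProductSpace ℂ E] [FiniteDimensional ℂ E] {n : Type u} {T : n → E →ₗ[ℂ] E}
    (hT : ∀ i, (T i).IsSymmetric) (hc : ∀ i j, Commute (T i) (T j)) :
    ∃ (κ : Type u) (v : κ → E), Orthonormal ℂ v ∧ Submodule.span ℂ (Set.range v) = ⊤ ∧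
      ∀ a, ∃ χ : n → ℂ, ∀ i, T i (v a) = χ i • v a := by
  let V : (n → ℂ) → Submodule ℂ E := fun χ => ⨅ i, Module.End.eigenspace (T i) (χ i)
  have hV : OrthogonalFamily ℂ (fun χ => V χ) fun χ => (V χ).subtypeₗᵢ :=
    LinearMap.IsSymmetric.orthogonalFamily_iInf_eigenspaces hT
  have htop : ⨆ χ, V χ = ⊤ :=
    LinearMap.IsSymmetric.iSup_iInf_eq_top_of_commute hT fun i j _ => hc i j
  refine ⟨Σ χ, Fin (Module.finrank ℂ (V χ)), fun a => (stdOrthonormalBasis ℂ (V a.1) a.2 : E),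
    hV.orthonormal_sigma_orthonormal fun χ => (stdOrthonormalBasis ℂ (V χ)).orthonormal, ?_, ?_⟩
  · rw [eq_top_iff, ← htop, iSup_le_iff]
    intro χ
    have h1 := congrArg (Submodule.map (V χ).subtype) (stdOrthonormalBasis ℂ (V χ)).toBasis.span_eq
    rw [Submodule.map_span, ← Set.range_comp, Submodule.map_subtype_top] at h1
    refine h1.symm.le.trans (Submodule.span_mono ?_)
    rintro _ ⟨i, rfl⟩
    exact ⟨⟨χ, i⟩, by simp⟩
  · rintro ⟨χ, i⟩
    refine ⟨χ, fun j => ?_⟩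
    have h1 := (stdOrthonormalBasis ℂ (V χ) i).2
    exact Module.End.mem_eigenspace_iff.mp ((Submodule.mem_iInf _).mp h1 j)

/-- The adjoints vanish on `Sᗮ`, and by normality so do the `A j`. The real and imaginary parts
therefore preserve the finite-dimensional `S` and commute there; a joint eigenbasis of `S` is
completed by vectors of `Sᗮ`, all of eigenvalue `0`. -/
theorem IsCommutingNormalFamily.exists_hilbertBasis [CompleteSpace H] {m : ℕ}
    {A : Fin m → H →L[ℂ] H} (h : IsCommutingNormalFamily A)
    (hA : ∀ j, FiniteDimensional ℂ (LinearMap.range (A j : H →ₗ[ℂ] H))) :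
    ∃ (w : Set H) (b : HilbertBasis w ℂ H) (d : w → Fin m → ℂ),
      ∀ i j, A j (b i) = d i j • b i := by
  set S : Submodule ℂ H := ⨆ j, LinearMap.range (A j : H →ₗ[ℂ] H) with hS
  have hSfin : FiniteDimensional ℂ S := Submodule.finiteDimensional_iSup _
  have hAS : ∀ j z, A j z ∈ S := fun j z => Submodule.mem_iSup_of_mem j ⟨z, rfl⟩
  have hnormal := h.1
  have hstar0 : ∀ j, ∀ z ∈ Sᗮ, star (A j) z = 0 := by
    intro j z hz
    rw [← inner_self_eq_zero (𝕜 := ℂ), ContinuousLinearMap.star_eq_adjoint,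
      ContinuousLinearMap.adjoint_inner_right]
    exact hz _ (hAS j _)
  have h0 : ∀ j, ∀ z ∈ Sᗮ, A j z = 0 := by
    intro j z hz
    have h1 := ContinuousLinearMap.isStarNormal_iff_norm_eq_adjoint.mp (hnormal j) z
    rw [← ContinuousLinearMap.star_eq_adjoint, hstar0 j z hz, norm_zero] at h1
    exact norm_eq_zero.mp h1
  have hstarS : ∀ j z, star (A j) z ∈ S := by
    intro j z
    rw [← Submodule.orthogonal_orthogonal S]
    intro w hw
    rw [ContinuousLinearMap.star_eq_adjoint, ContinuousLinearMap.adjoint_inner_right, h0 j w hw,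
      inner_zero_left]
  have hAA' : ∀ i j, Commute (A i) (star (A j)) := fun i j =>
    (hnormal j).commute_star_right (h.2 i j)
  have hA'A' : ∀ i j, Commute (star (A i)) (star (A j)) := fun i j => (h.2 i j).star_star
  have hRe : ∀ j, (ℜ (A j) : H →L[ℂ] H) = (2⁻¹ : ℝ) • (A j + star (A j)) := fun j => by
    simp [realPart_apply_coe]
  have hIm : ∀ j, (ℑ (A j) : H →L[ℂ] H) = -Complex.I • (2⁻¹ : ℝ) • (A j - star (A j)) :=
    fun j => by simp [imaginaryPart_apply_coe]
  let T : Fin m ⊕ Fin m → H →L[ℂ] H :=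
    Sum.elim (fun j => (ℜ (A j) : H →L[ℂ] H)) (fun j => (ℑ (A j) : H →L[ℂ] H))
  have hTsa : ∀ i, IsSelfAdjoint (T i) := by
    rintro (j | j)
    · exact (ℜ (A j)).2
    · exact (ℑ (A j)).2
  have hp : ∀ i j, Commute (A i + star (A i)) (A j + star (A j)) := fun i j =>
    ((h.2 i j).add_right (hAA' i j)).add_left ((hAA' j i).symm.add_right (hA'A' i j))
  have hpm : ∀ i j, Commute (A i + star (A i)) (A j - star (A j)) := fun i j =>
    ((h.2 i j).sub_right (hAA' i j)).add_left ((hAA' j i).symm.sub_right (hA'A' i j))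
  have hm : ∀ i j, Commute (A i - star (A i)) (A j - star (A j)) := fun i j =>
    ((h.2 i j).sub_right (hAA' i j)).sub_left ((hAA' j i).symm.sub_right (hA'A' i j))
  have hTc : ∀ i j, Commute (T i) (T j) := by
    rintro (i | i) (j | j)
    · simp only [T, Sum.elim_inl, hRe]
      exact ((hp i j).smul_right _).smul_left _
    · simp only [T, Sum.elim_inl, Sum.elim_inr, hRe, hIm]
      exact (((hpm i j).smul_right _).smul_right _).smul_left _
    · simp only [T, Sum.elim_inl, Sum.elim_inr, hRe, hIm]
      exact (((hpm j i).symm.smul_right _).smul_left _).smul_left _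
    · simp only [T, Sum.elim_inr, hIm]
      exact ((((hm i j).smul_right _).smul_right _).smul_left _).smul_left _
  have hTS : ∀ i, ∀ z ∈ S, T i z ∈ S := by
    rintro (j | j) z -
    · simp only [T, Sum.elim_inl, hRe]
      exact S.smul_of_tower_mem _ (S.add_mem (hAS j z) (hstarS j z))
    · simp only [T, Sum.elim_inr, hIm]
      exact S.smul_mem _ (S.smul_of_tower_mem _ (S.sub_mem (hAS j z) (hstarS j z)))
  obtain ⟨κ, v, hv, hspan, hχ⟩ := exists_orthonormal_joint_eigenvectors
    (T := fun i => (T i).toLinearMap.restrict (hTS i))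
    (fun i => (hTsa i).isSymmetric.restrict_invariant (hTS i))
    (fun i j => by
      ext z
      exact DFunLike.congr_fun (hTc i j).eq (z : H))
  have hv' : Orthonormal ℂ (fun a => (v a : H)) := hv.comp_linearIsometry S.subtypeₗᵢ
  have hspan' : Submodule.span ℂ (Set.range fun a => (v a : H)) = S := by
    have := congrArg (Submodule.map S.subtype) hspan
    rwa [Submodule.map_span, ← Set.range_comp, Submodule.map_subtype_top] at this
  obtain ⟨w, b, hw, hb⟩ := hv'.toSubtypeRange.exists_hilbertBasis_extension
  have key : ∀ i : w, ∃ d : Fin m → ℂ, ∀ j, A j (b i) = d j • b i := by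
    intro i
    by_cases hi : (i : H) ∈ Set.range fun a => (v a : H)
    · obtain ⟨a, ha⟩ := hi
      obtain ⟨χ, hχ⟩ := hχ a
      refine ⟨fun j => χ (Sum.inl j) + Complex.I * χ (Sum.inr j), fun j => ?_⟩
      have h1 : (ℜ (A j) : H →L[ℂ] H) (v a) = χ (Sum.inl j) • (v a : H) :=
        congrArg Subtype.val (hχ (Sum.inl j))
      have h2 : (ℑ (A j) : H →L[ℂ] H) (v a) = χ (Sum.inr j) • (v a : H) :=
        congrArg Subtype.val (hχ (Sum.inr j))
      rw [hb]
      simp only at ha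
      rw [← ha]
      conv_lhs => rw [← realPart_add_I_smul_imaginaryPart (A j)]
      rw [add_apply, smul_apply, h1, h2, smul_smul, add_smul]
    · refine ⟨0, fun j => ?_⟩
      rw [Pi.zero_apply, zero_smul]
      refine h0 j _ ?_
      rw [← hspan', Submodule.mem_orthogonal]
      intro u hu
      induction hu using Submodule.span_induction with
      | mem u hu =>
        have h1 := b.orthonormal.2 (i := ⟨u, hw hu⟩) (j := i) (by
          rintro rfl; exact hi hu)
        rwa [hb] at h1 ⊢
      | zero => simp
      | add u u' _ _ h1 h2 => rw [inner_add_left, h1, h2, add_zero]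
      | smul c u _ h1 => rw [inner_smul_left, h1, mul_zero]
  choose d hd using key
  exact ⟨w, b, d, hd⟩

theorem IsCommutingNormalFamily.exists_unitary_isDiagonalOperator [CompleteSpace H]
    (hH : ¬ FiniteDimensional ℂ H) {ι : Type*} (e : HilbertBasis ι ℂ H) {m : ℕ}
    {A : Fin m → H →L[ℂ] H} (h : IsCommutingNormalFamily A)
    (hA : ∀ j, FiniteDimensional ℂ (LinearMap.range (A j : H →ₗ[ℂ] H))) :
    ∃ U ∈ unitary (H →L[ℂ] H), ∀ j, IsDiagonalOperator e (star U * A j * U) := by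
  classical
  obtain ⟨w, b, d, hd⟩ := h.exists_hilbertBasis hA
  obtain ⟨σ⟩ := e.nonempty_equiv hH b
  have hrange : Set.range (b ∘ σ) = Set.range b := σ.surjective.range_comp b
  let f : HilbertBasis ι ℂ H := HilbertBasis.mk (b.orthonormal.comp σ σ.injective) (by
    rw [hrange, b.dense_span])
  have hf : ∀ i, f i = b (σ i) := fun i => by
    rw [HilbertBasis.coe_mk]; rfl
  let V : H ≃ₗᵢ[ℂ] H := e.repr.trans f.repr.symm
  have hV : ∀ i, V (e i) = b (σ i) := fun i => by
    rw [← hf, ← f.repr_symm_single, ← e.repr_self]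
    rfl
  let U := Unitary.linearIsometryEquiv.symm V
  refine ⟨U, U.2, fun j => ⟨fun i => d (σ i) j, fun i => ?_⟩⟩
  have hU : (U : H →L[ℂ] H) (e i) = b (σ i) := hV i
  rw [mul_apply_eq_comp, hU, mul_apply_eq_comp, hd, map_smul, ← hU,
    ← mul_apply_eq_comp, Unitary.coe_star_mul_self]
  rfl
end

/-! ### The hypersimplex and the finite carpenter theorem. -/

/-- The points of the unit cube whose coordinates have sum `k`. -/
def hypersimplex (κ : Type*) [Fintype κ] (k : ℕ) : Set (κ → ℝ) :=
  {s | (∀ i, 0 ≤ s i ∧ s i ≤ 1) ∧ ∑ i, s i = k}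

set_option linter.unusedSimpArgs false in
theorem Orthonormal.rotate {κ : Type*} [DecidableEq κ] {H : Type*}
    [NormedAddCommGroup H] [InnerProductSpace ℂ H] {g : κ → H} (hg : Orthonormal ℂ g) {i j : κ} (hij : i ≠ j)
    {c e : ℝ} (hce : c ^ 2 + e ^ 2 = 1) :
    Orthonormal ℂ (fun n => if n = i then (c : ℂ) • g i + (e : ℂ) • g j else
      if n = j then -(e : ℂ) • g i + (c : ℂ) • g j else g n) := by
  have h := orthonormal_iff_ite.mp hg
  have hce' : (c : ℂ) * c + e * e = 1 := by
    rw [← pow_two, ← pow_two]; exact_mod_cast hce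
  rw [orthonormal_iff_ite]
  intro n n'
  by_cases h1 : n = i
  · by_cases h2 : n' = i
    · simp only [h1, h2, hij, hij.symm, if_true, if_false, inner_add_left, inner_add_right, inner_smul_left,
          inner_smul_right, h, map_neg, Complex.conj_ofReal]
      linear_combination hce'
    · by_cases h3 : n' = j
      · simp only [h1, h3, hij, hij.symm, if_true, if_false, inner_add_left, inner_add_right, inner_smul_left,
          inner_smul_right, h, map_neg, Complex.conj_ofReal]
        ring
      · simp only [h1, h2, h3, Ne.symm h2, Ne.symm h3, if_true, if_false, inner_add_left, inner_add_right, inner_smul_left,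
          inner_smul_right, h, map_neg, Complex.conj_ofReal]
        ring
  · by_cases h1' : n = j
    · by_cases h2 : n' = i
      · simp only [h1', h2, hij, hij.symm, if_true, if_false, inner_add_left, inner_add_right, inner_smul_left,
          inner_smul_right, h, map_neg, Complex.conj_ofReal]
        ring
      · by_cases h3 : n' = j
        · simp only [h1', h3, hij, hij.symm, if_true, if_false, inner_add_left, inner_add_right, inner_smul_left,
          inner_smul_right, h, map_neg, Complex.conj_ofReal]
          linear_combination hce'
        · simp only [h1', h2, h3, hij.symm, Ne.symm h2, Ne.symm h3, if_true, if_false, inner_add_left, inner_add_right, inner_smul_left,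
          inner_smul_right, h, map_neg, Complex.conj_ofReal]
          ring
    · by_cases h2 : n' = i
      · simp only [h1, h1', h2, if_true, if_false, inner_add_left, inner_add_right, inner_smul_left,
          inner_smul_right, h, map_neg, Complex.conj_ofReal]
        ring
      · by_cases h3 : n' = j
        · simp only [h1, h1', h3, hij.symm, if_true, if_false, inner_add_left, inner_add_right, inner_smul_left,
          inner_smul_right, h, map_neg, Complex.conj_ofReal]
          ring
        · simp only [h1, h1', h2, h3, if_false, h]

section
variable {κ : Type*} [Fintype κ]

theorem convex_hypersimplex (k : ℕ) : Convex ℝ (hypersimplex κ k) := by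
  intro s hs t ht a b ha hb hab
  refine ⟨fun i => ?_, ?_⟩
  · have h1 := hs.1 i
    have h2 := ht.1 i
    simp only [Pi.add_apply, Pi.smul_apply, smul_eq_mul]
    constructor
    · exact add_nonneg (mul_nonneg ha h1.1) (mul_nonneg hb h2.1)
    · nlinarith
  · simp only [Pi.add_apply, Pi.smul_apply, smul_eq_mul, Finset.sum_add_distrib,
      ← Finset.mul_sum, hs.2, ht.2]
    rw [← add_mul, hab, one_mul]

/-- The total is an integer, so a single fractional coordinate is impossible. -/
theorem exists_ne_fractional_of_mem_hypersimplex {k : ℕ} {s : κ → ℝ}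
    (hs : s ∈ hypersimplex κ k) {i : κ} (hi0 : s i ≠ 0) (hi1 : s i ≠ 1) :
    ∃ j, j ≠ i ∧ s j ≠ 0 ∧ s j ≠ 1 := by
  classical
  by_contra! h
  have h1 : ∀ j ∈ Finset.univ.erase i, s j = ((if s j = 0 then 0 else 1 : ℤ) : ℝ) := by
    intro j hj
    by_cases h0 : s j = 0
    · simp [h0]
    · simp [h j (Finset.ne_of_mem_erase hj) h0]
  have h2 := hs.2
  rw [← Finset.add_sum_erase _ _ (Finset.mem_univ i), Finset.sum_congr rfl h1,
    ← Int.cast_sum] at h2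
  generalize ∑ j ∈ Finset.univ.erase i, (if s j = 0 then 0 else 1 : ℤ) = z at h2
  have h3 : s i = (((k : ℤ) - z : ℤ) : ℝ) := by push_cast; linarith
  have h4 := (hs.1 i).1.lt_of_ne' hi0
  have h5 := (hs.1 i).2.lt_of_ne hi1
  rw [h3] at h4 h5
  norm_cast at h4 h5
  omega

variable [DecidableEq κ]

/-- Every point of the hypersimplex is obtained from its vertices by averaging points with their
images under transpositions. -/
theorem hypersimplex_induction {k : ℕ} {p : (κ → ℝ) → Prop}
    (vertex : ∀ J : Finset κ, J.card = k → p (fun i => if i ∈ J then 1 else 0))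
    (average : ∀ s ∈ hypersimplex κ k, ∀ i j, i ≠ j → (s i = 1 ∨ s j = 0) →
      ∀ a : ℝ, 0 ≤ a → a ≤ 1 → p s → p (s ∘ Equiv.swap i j) →
      p (a • s + (1 - a) • (s ∘ Equiv.swap i j)))
    {s : κ → ℝ} (hs : s ∈ hypersimplex κ k) : p s := by
  induction hn : (Finset.univ.filter fun i => s i ≠ 0 ∧ s i ≠ 1).card using
    Nat.strong_induction_on generalizing s with
  | _ n ih =>
  by_cases hne : ∃ i, s i ≠ 0 ∧ s i ≠ 1
  · obtain ⟨i, hi0, hi1⟩ := hne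
    obtain ⟨j, hji, hj0, hj1⟩ := exists_ne_fractional_of_mem_hypersimplex hs hi0 hi1
    have hi := hs.1 i
    have hj := hs.1 j
    have hi0' := hi.1.lt_of_ne' hi0
    have hj0' := hj.1.lt_of_ne' hj0
    have hi1' := hi.2.lt_of_ne hi1
    have hj1' := hj.2.lt_of_ne hj1
    -- Mass moves from `j` to `i` until coordinate `j` reaches `0` or coordinate `i` reaches `1`.
    -- The point `s` lies on the segment between the result and its transpose, and both have fewer
    -- fractional coordinates.
    obtain ⟨u, v, huv, hu0, hu1, hv0, hv1, hint, hvi, hiu, hlt⟩ :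
        ∃ u v : ℝ, u + v = s i + s j ∧ 0 ≤ u ∧ u ≤ 1 ∧ 0 ≤ v ∧ v ≤ 1 ∧ (u = 1 ∨ v = 0) ∧
          v ≤ s i ∧ s i ≤ u ∧ v < u := by
      rcases le_total (s i + s j) 1 with h | h
      · exact ⟨s i + s j, 0, by ring, by linarith, h, le_rfl, zero_le_one, Or.inr rfl,
          by linarith, by linarith, by linarith⟩
      · exact ⟨1, s i + s j - 1, by ring, zero_le_one, le_rfl, by linarith, by linarith,
          Or.inl rfl, by linarith, by linarith, by linarith⟩
    set s' : κ → ℝ := Function.update (Function.update s i u) j v with hs'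
    have hs'j : s' j = v := by simp [hs']
    have hs'i : s' i = u := by simp [hs', hji.symm]
    have hs'n : ∀ n, n ≠ i → n ≠ j → s' n = s n := fun n h1 h2 => by simp [hs', h1, h2]
    have hmem : s' ∈ hypersimplex κ k := by
      refine ⟨fun n => ?_, ?_⟩
      · by_cases h1 : n = i
        · subst h1; rw [hs'i]; exact ⟨hu0, hu1⟩
        by_cases h2 : n = j
        · subst h2; rw [hs'j]; exact ⟨hv0, hv1⟩
        rw [hs'n n h1 h2]; exact hs.1 n
      · rw [← hs.2, ← sub_eq_zero, ← Finset.sum_sub_distrib,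
          ← Finset.add_sum_erase _ _ (Finset.mem_univ i), ← Finset.add_sum_erase _ _
            (Finset.mem_erase.mpr ⟨hji, Finset.mem_univ j⟩), Finset.sum_eq_zero, hs'i, hs'j]
        · linarith
        · intro n hn
          simp only [Finset.mem_erase] at hn
          rw [hs'n n hn.2.1 hn.1, sub_self]
    have hmem' : s' ∘ Equiv.swap i j ∈ hypersimplex κ k :=
      ⟨fun n => hmem.1 _, by rw [← hmem.2]; exact Equiv.sum_comp (Equiv.swap i j) s'⟩
    have hcard : ∀ t : κ → ℝ, (∀ n, n ≠ i → n ≠ j → t n = s n) →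
        ((t i = 0 ∨ t i = 1) ∨ (t j = 0 ∨ t j = 1)) →
        (Finset.univ.filter fun i => t i ≠ 0 ∧ t i ≠ 1).card < n := by
      intro t ht hor
      rw [← hn]
      apply Finset.card_lt_card
      rw [Finset.ssubset_iff_of_subset]
      · rcases hor with h | h
        · exact ⟨i, by simp [hi0, hi1], by simp; tauto⟩
        · exact ⟨j, by simp [hj0, hj1], by simp; tauto⟩
      · intro n hn
        simp only [Finset.mem_filter, Finset.mem_univ, true_and] at hn ⊢
        by_cases h1 : n = i
        · subst h1; exact ⟨hi0, hi1⟩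
        by_cases h2 : n = j
        · subst h2; exact ⟨hj0, hj1⟩
        rwa [← ht n h1 h2]
    have p1 : p s' := ih _ (hcard s' hs'n (by rw [hs'i, hs'j]; tauto)) hmem rfl
    have p2 : p (s' ∘ Equiv.swap i j) := by
      refine ih _ (hcard _ (fun n h1 h2 => ?_) ?_) hmem' rfl
      · rw [Function.comp_apply, Equiv.swap_apply_of_ne_of_ne h1 h2, hs'n n h1 h2]
      · simp only [Function.comp_apply, Equiv.swap_apply_left, Equiv.swap_apply_right, hs'i, hs'j]
        tauto
    have hpos : 0 < u - v := sub_pos.mpr hlt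
    have h3 := average s' hmem i j hji.symm (by rwa [hs'i, hs'j]) ((s i - v) / (u - v))
      (div_nonneg (by linarith) hpos.le) ((div_le_one hpos).mpr (by linarith)) p1 p2
    convert h3 using 1
    have hcoef : (s i - v) / (u - v) * (u - v) = s i - v := div_mul_cancel₀ _ hpos.ne'
    ext n
    simp only [Pi.add_apply, Pi.smul_apply, smul_eq_mul, Function.comp_apply]
    by_cases h1 : n = i
    · subst h1
      rw [Equiv.swap_apply_left, hs'i, hs'j]
      linarith
    by_cases h2 : n = j
    · subst h2
      rw [Equiv.swap_apply_right, hs'i, hs'j]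
      linarith
    rw [Equiv.swap_apply_of_ne_of_ne h1 h2, hs'n n h1 h2]
    ring
  · push Not at hne
    have h1 : s = fun i => if i ∈ Finset.univ.filter (fun i => s i = 1) then 1 else 0 := by
      ext i
      by_cases h0 : s i = 0
      · simp [h0]
      · simp [hne i h0]
    rw [h1]
    refine vertex _ ?_
    have h2 := hs.2
    rw [h1] at h2
    simp only [Finset.sum_ite_mem, Finset.univ_inter, Finset.sum_const, nsmul_eq_mul,
      mul_one] at h2
    exact_mod_cast h2

variable {H : Type*} [NormedAddCommGroup H] [InnerProductSpace ℂ H]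

/-- Equality in Bessel's inequality leaves no component of `g` outside the span of `x`. -/
theorem Orthonormal.sum_inner_smul_eq_of_sum_norm_sq_eq {k : ℕ} {x : Fin k → H}
    (hx : Orthonormal ℂ x) {g : H} (h : ∑ l, ‖⟪x l, g⟫_ℂ‖ ^ 2 = ‖g‖ ^ 2) :
    ∑ l, ⟪x l, g⟫_ℂ • x l = g := by
  set z := ∑ l, ⟪x l, g⟫_ℂ • x l with hz
  have h1 : ⟪g, z⟫_ℂ = ((‖g‖ ^ 2 : ℝ) : ℂ) := by
    rw [hz, inner_sum, ← h, Complex.ofReal_sum]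
    refine Finset.sum_congr rfl fun l _ => ?_
    rw [inner_smul_right, ← inner_conj_symm g, Complex.mul_conj']
    push_cast; rfl
  have h2 : ⟪z, z⟫_ℂ = ((‖g‖ ^ 2 : ℝ) : ℂ) := by
    rw [hz, hx.inner_sum, ← h, Complex.ofReal_sum]
    refine Finset.sum_congr rfl fun l _ => ?_
    rw [Complex.conj_mul']
    push_cast; rfl
  have h3 : ⟪z, g⟫_ℂ = ((‖g‖ ^ 2 : ℝ) : ℂ) := by
    rw [← inner_conj_symm, h1, Complex.conj_ofReal]
  rw [← sub_eq_zero, ← inner_self_eq_zero (𝕜 := ℂ), inner_sub_left, inner_sub_right,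
    inner_sub_right, h1, h2, h3, inner_self_eq_norm_sq_to_K]
  push_cast
  simp

theorem sum_norm_sq_inner_combination {k : ℕ} {x : Fin k → H} {u v : H}
    (h : ∑ l, ⟪u, x l⟫_ℂ * ⟪x l, v⟫_ℂ = 0) (c e : ℝ) :
    ∑ l, ‖⟪x l, (c : ℂ) • u + (e : ℂ) • v⟫_ℂ‖ ^ 2
      = c ^ 2 * ∑ l, ‖⟪x l, u⟫_ℂ‖ ^ 2 + e ^ 2 * ∑ l, ‖⟪x l, v⟫_ℂ‖ ^ 2 := by
  have h1 : ∀ l, ‖⟪x l, (c : ℂ) • u + (e : ℂ) • v⟫_ℂ‖ ^ 2 = c ^ 2 * ‖⟪x l, u⟫_ℂ‖ ^ 2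
      + e ^ 2 * ‖⟪x l, v⟫_ℂ‖ ^ 2 + 2 * c * e * (⟪u, x l⟫_ℂ * ⟪x l, v⟫_ℂ).re := by
    intro l
    rw [← inner_conj_symm u, inner_add_right, inner_smul_right, inner_smul_right]
    simp only [← Complex.normSq_eq_norm_sq, Complex.normSq_apply, Complex.add_re, Complex.add_im,
      Complex.mul_re, Complex.mul_im, Complex.ofReal_re, Complex.ofReal_im, Complex.conj_re,
      Complex.conj_im]
    ring
  simp_rw [h1, Finset.sum_add_distrib, ← Finset.mul_sum, ← Complex.re_sum, h]
  simp

/-- The finite carpenter theorem: a sequence in `[0, 1]` with integral sum `k` is the diagonal of a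
projection of rank `k`. -/
theorem exists_orthonormal_of_mem_hypersimplex {k : ℕ} {s : κ → ℝ} (hs : s ∈ hypersimplex κ k)
    {g : κ → H} (hg : Orthonormal ℂ g) :
    ∃ x : Fin k → H, Orthonormal ℂ x ∧ ∀ i, ∑ l, ‖⟪x l, g i⟫_ℂ‖ ^ 2 = s i := by
  refine hypersimplex_induction (p := fun s => ∀ g : κ → H, Orthonormal ℂ g →
    ∃ x : Fin k → H, Orthonormal ℂ x ∧ ∀ i, ∑ l, ‖⟪x l, g i⟫_ℂ‖ ^ 2 = s i) ?_ ?_ hs g hg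
  · intro J hJ g hg
    let σ := Finset.equivFinOfCardEq hJ
    refine ⟨fun l => g (σ.symm l), hg.comp _ (Subtype.val_injective.comp σ.symm.injective), ?_⟩
    intro i
    have h := orthonormal_iff_ite.mp hg
    rw [Equiv.sum_comp σ.symm (fun j : J => ‖⟪g j, g i⟫_ℂ‖ ^ 2),
      Finset.sum_coe_sort J (fun j => ‖⟪g j, g i⟫_ℂ‖ ^ 2)]
    simp [h, apply_ite]
  · intro s hs i j hij hint a ha0 ha1 ih _ g hg
    have hc : √a ^ 2 = a := Real.sq_sqrt ha0
    have he : √(1 - a) ^ 2 = 1 - a := Real.sq_sqrt (by linarith)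
    generalize √a = c at hc
    generalize √(1 - a) = e at he
    have hce : c ^ 2 + e ^ 2 = 1 := by rw [hc, he]; ring
    have hce' : (c : ℂ) * c + e * e = 1 := by
      rw [← pow_two, ← pow_two]; exact_mod_cast hce
    -- The induction hypothesis is used for the pair `g i`, `g j` rotated by the angle with squared
    -- cosine `a`. Rotating back mixes the two diagonal entries with weights `a` and `1 - a`,
    -- provided the cross term vanishes.
    have hrot := hg.rotate hij hce
    obtain ⟨x, hx, hxs⟩ := ih _ hrot
    have hi := hxs i
    have hj := hxs j
    have horth := hrot.2 hij
    have hni := hrot.1 i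
    simp only [if_true, if_neg hij.symm] at hi hj horth hni
    set u := (c : ℂ) • g i + (e : ℂ) • g j with hu
    set v := -(e : ℂ) • g i + (c : ℂ) • g j with hv
    -- An entry `1` at `i` puts `u` into the span of `x`, so the sum is `⟪u, v⟫ = 0`; an entry `0`
    -- at `j` makes `v` orthogonal to every `x l`.
    have hcross : ∑ l, ⟪u, x l⟫_ℂ * ⟪x l, v⟫_ℂ = 0 := by
      rcases hint with h | h
      · have h1 := hx.sum_inner_smul_eq_of_sum_norm_sq_eq (g := u) (by rw [hi, h, hni]; norm_num)
        conv_lhs at horth => rw [← h1]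
        rw [sum_inner] at horth
        rw [← horth]
        refine Finset.sum_congr rfl fun l _ => ?_
        rw [inner_smul_left, inner_conj_symm]
      · rw [h, Finset.sum_eq_zero_iff_of_nonneg (fun l _ => by positivity)] at hj
        refine Finset.sum_eq_zero fun l hl => ?_
        have := hj l hl
        rw [pow_eq_zero_iff two_ne_zero, norm_eq_zero] at this
        rw [this, mul_zero]
    refine ⟨x, hx, fun n => ?_⟩
    simp only [Pi.add_apply, Pi.smul_apply, smul_eq_mul, Function.comp_apply]
    by_cases h1 : n = i
    · subst h1
      have hgi : g n = (c : ℂ) • u + ((-e : ℝ) : ℂ) • v := by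
        have : (c : ℂ) • u + ((-e : ℝ) : ℂ) • v = ((c : ℂ) * c + e * e) • g n := by
          rw [hu, hv]; push_cast; module
        rw [this, hce', one_smul]
      rw [Equiv.swap_apply_left, hgi, sum_norm_sq_inner_combination hcross, hi, hj, hc, neg_sq, he]
    by_cases h2 : n = j
    · subst h2
      have hgj : g n = (e : ℂ) • u + (c : ℂ) • v := by
        have : (e : ℂ) • u + (c : ℂ) • v = ((c : ℂ) * c + e * e) • g n := by
          rw [hu, hv]; module
        rw [this, hce', one_smul]
      rw [Equiv.swap_apply_right, hgj, sum_norm_sq_inner_combination hcross, hi, hj, hc, he]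
      ring
    have hn := hxs n
    simp only [if_neg h1, if_neg h2] at hn
    rw [Equiv.swap_apply_of_ne_of_ne h1 h2, hn]
    ring
end

/-! ### The range as a linear image of a hypersimplex. -/

section
variable {H : Type*} [NormedAddCommGroup H] [InnerProductSpace ℂ H]

theorem HilbertBasis.inner_map_self_eq_sum {ι : Type*} (b : HilbertBasis ι ℂ H)
    {T : H →L[ℂ] H} {d : ι → ℂ} (hT : ∀ i, T (b i) = d i • b i) {N : Finset ι}
    (hN : ∀ i, i ∉ N → d i = 0) (x : H) :
    ⟪x, T x⟫_ℂ = ∑ i ∈ N, ((‖⟪x, b i⟫_ℂ‖ ^ 2 : ℝ) : ℂ) * d i := by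
  have h1 := (b.hasSum_repr x).mapL (innerSL ℂ x ∘L T)
  have h2 := hasSum_sum_of_ne_finset_zero (L := SummationFilter.unconditional ι)
    (f := fun i => (innerSL ℂ x ∘L T) (b.repr x i • b i)) (s := N) (by
      intro i hi
      simp [hT, hN i hi])
  refine (h1.unique h2).trans (Finset.sum_congr rfl fun i _ => ?_)
  rw [map_smul, b.repr_apply_apply, ContinuousLinearMap.comp_apply, hT, map_smul, innerSL_apply_apply,
    smul_eq_mul, smul_eq_mul, ← inner_conj_symm (b i) x, Complex.ofReal_pow, ← Complex.conj_mul']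
  ring

theorem HilbertBasis.finite_setOf_apply_mem {ι : Type*} (b : HilbertBasis ι ℂ H)
    (S : Submodule ℂ H) [FiniteDimensional ℂ S] : {i | b i ∈ S}.Finite := by
  have h1 : LinearIndependent ℂ (fun i : {i | b i ∈ S} => (⟨b i, i.2⟩ : S)) := by
    apply LinearIndependent.of_comp S.subtype
    exact b.orthonormal.linearIndependent.comp _ Subtype.val_injective
  have := h1.finite
  exact Set.toFinite _

theorem isPolyhedral_kNumericalRange_of_hilbertBasis (hH : ¬ FiniteDimensional ℂ H) {ι : Type*}
    (b : HilbertBasis ι ℂ H) {m : ℕ} {A : Fin m → H →L[ℂ] H}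
    (hA : ∀ j, FiniteDimensional ℂ (LinearMap.range (A j : H →ₗ[ℂ] H)))
    {d : Fin m → ι → ℂ} (hd : ∀ j i, A j (b i) = d j i • b i) {k : ℕ} (hk : 1 ≤ k) :
    IsPolyhedral (kNumericalRange k A) := by
  classical
  have hinf := b.infinite_of_not_finiteDimensional hH
  set S : Submodule ℂ H := ⨆ j, LinearMap.range (A j : H →ₗ[ℂ] H) with hS
  have hSfin : FiniteDimensional ℂ S := Submodule.finiteDimensional_iSup _
  let N : Finset ι := (b.finite_setOf_apply_mem S).toFinset
  have hN : ∀ i, i ∉ N → ∀ j, d j i = 0 := by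
    intro i hi j
    by_contra h
    refine hi ((Set.Finite.mem_toFinset _).mpr ?_)
    have h1 : A j (b i) ∈ S := Submodule.mem_iSup_of_mem j ⟨b i, rfl⟩
    rw [hd] at h1
    exact (S.smul_mem_iff h).mp h1
  -- The `k` extra indices have eigenvalue `0` and absorb the trace that a `k`-system has outside
  -- `N`.
  obtain ⟨N', hNN', hN'card⟩ := Infinite.exists_superset_card_eq N (N.card + k) (by omega)
  have hextra : (N' \ N).card = k := by
    rw [Finset.card_sdiff_of_subset hNN']; omega
  let L : (N' → ℝ) → Fin m → ℂ := fun s j => ∑ i : N', (s i : ℂ) * d j i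
  have hLadd : ∀ (s t : N' → ℝ) (p q : ℝ), L (p • s + q • t) = p • L s + q • L t := by
    intro s t p q
    ext j
    simp only [L, Pi.add_apply, Pi.smul_apply, Complex.real_smul, smul_eq_mul, Finset.mul_sum,
      ← Finset.sum_add_distrib]
    refine Finset.sum_congr rfl fun i _ => ?_
    push_cast
    ring
  let vertex : Finset N' → Fin m → ℂ := fun J => L (fun i => if i ∈ J then 1 else 0)
  refine ⟨vertex '' {J | J.card = k}, (Set.toFinite _).image _, Set.Subset.antisymm ?_ ?_⟩
  · rintro v ⟨x, hx, hv⟩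
    let t : ι → ℝ := fun i => ∑ l, ‖⟪x l, b i⟫_ℂ‖ ^ 2
    have ht0 : ∀ i, 0 ≤ t i := fun i => Finset.sum_nonneg fun l _ => by positivity
    have ht1 : ∀ i, t i ≤ 1 := fun i => by
      refine (hx.sum_inner_products_le (b i) (s := Finset.univ)).trans_eq ?_
      rw [b.orthonormal.1 i]; norm_num
    have htsum : ∑ i ∈ N, t i ≤ k := by
      rw [Finset.sum_comm]
      refine (Finset.sum_le_card_nsmul Finset.univ _ 1 fun l _ => ?_).trans (by simp)
      simp_rw [norm_inner_symm (x l)]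
      refine (b.orthonormal.sum_inner_products_le (x l) (s := N)).trans_eq ?_
      rw [hx.1 l]; norm_num
    have hk0 : (0 : ℝ) < k := by exact_mod_cast hk
    -- The missing mass lies between `0` and `k`; shared equally by the `k` extra indices, it gives
    -- entries in `[0, 1]`.
    let s' : ι → ℝ := fun i => if i ∈ N then t i else (k - ∑ i ∈ N, t i) / k
    let s : N' → ℝ := fun i => s' i
    have hs : s ∈ hypersimplex N' k := by
      constructor
      · intro i
        by_cases hi : (i : ι) ∈ N
        · simp only [s, s', if_pos hi]
          exact ⟨ht0 _, ht1 _⟩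
        · simp only [s, s', if_neg hi]
          have := Finset.sum_nonneg (s := N) fun i _ => ht0 i
          exact ⟨div_nonneg (by linarith) hk0.le, (div_le_one hk0).mpr (by linarith)⟩
      · rw [Finset.sum_coe_sort N' s', ← Finset.sum_sdiff hNN',
          Finset.sum_congr rfl (g := fun _ => (k - ∑ i ∈ N, t i) / k) (fun i hi => by
            simp only [s', if_neg (Finset.mem_sdiff.mp hi).2]),
          Finset.sum_congr (s₁ := N) (f := s') (g := t) rfl (fun i hi => if_pos hi),
          Finset.sum_const, hextra, nsmul_eq_mul, mul_div_cancel₀ _ hk0.ne', sub_add_cancel]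
    have hvL : v = L s := by
      ext j
      rw [hv j]
      simp_rw [fun l => b.inner_map_self_eq_sum (hd j) (fun i hi => hN i hi j) (x l)]
      rw [Finset.sum_comm]
      simp only [L, s]
      rw [Finset.sum_coe_sort N' (fun i => (s' i : ℂ) * d j i), ← Finset.sum_subset hNN']
      · refine Finset.sum_congr rfl fun i hi => ?_
        simp only [s', if_pos hi, t]
        rw [← Finset.sum_mul, Complex.ofReal_sum]
      · intro i _ hi
        rw [hN i hi j, mul_zero]
    rw [hvL]
    refine hypersimplex_induction
      (p := fun s => L s ∈ convexHull ℝ (vertex '' {J | J.card = k})) ?_ ?_ hs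
    · exact fun J hJ => subset_convexHull ℝ _ ⟨J, hJ, rfl⟩
    · intro s _ i j _ _ a ha0 ha1 h1 h2
      rw [hLadd]
      exact convex_convexHull ℝ _ h1 h2 ha0 (by linarith) (by ring)
  · have hconv : Convex ℝ (L '' hypersimplex N' k) := by
      rintro _ ⟨s, hs, rfl⟩ _ ⟨t, ht, rfl⟩ p q hp hq hpq
      exact ⟨p • s + q • t, convex_hypersimplex k hs ht hp hq hpq, hLadd s t p q⟩
    have hsub : convexHull ℝ (vertex '' {J | J.card = k}) ⊆ L '' hypersimplex N' k := by
      refine convexHull_min ?_ hconv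
      rintro _ ⟨J, hJ, rfl⟩
      refine ⟨_, ⟨fun i => ?_, ?_⟩, rfl⟩
      · split_ifs <;> norm_num
      · rw [Finset.sum_boole, Finset.filter_univ_mem]
        exact congrArg Nat.cast hJ
    intro v hv
    obtain ⟨s, hs, rfl⟩ := hsub hv
    -- The carpenter theorem realizes every point of the hypersimplex, which makes `W_k` convex
    -- without passing to its hull.
    obtain ⟨x, hx, hxs⟩ := exists_orthonormal_of_mem_hypersimplex hs
      (b.orthonormal.comp (fun i : N' => (i : ι)) Subtype.val_injective)
    refine ⟨x, hx, fun j => ?_⟩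
    simp_rw [fun l => b.inner_map_self_eq_sum (hd j)
      (fun i hi => hN i (fun h => hi (hNN' h)) j) (x l)]
    rw [Finset.sum_comm, ← Finset.sum_coe_sort N']
    refine Finset.sum_congr rfl fun i _ => ?_
    rw [← Finset.sum_mul, ← Complex.ofReal_sum]
    congr 2
    exact (hxs i).symm

theorem exists_hilbertBasis_of_isDiagonalOperator [CompleteSpace H] {ι : Type*}
    (e : HilbertBasis ι ℂ H) {m : ℕ} {A : Fin m → H →L[ℂ] H} {U : H →L[ℂ] H}
    (hU : U ∈ unitary (H →L[ℂ] H)) (h : ∀ j, IsDiagonalOperator e (star U * A j * U)) :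
    ∃ (b : HilbertBasis ι ℂ H) (d : Fin m → ι → ℂ), ∀ j i, A j (b i) = d j i • b i := by
  classical
  let V : H ≃ₗᵢ[ℂ] H := Unitary.linearIsometryEquiv ⟨U, hU⟩
  have hVU : ∀ z, V z = U z := fun z => rfl
  let b : HilbertBasis ι ℂ H := HilbertBasis.ofRepr (V.symm.trans e.repr)
  have hb : ∀ i, b i = U (e i) := fun i => by
    rw [← hVU, ← b.repr_symm_single, ← e.repr_symm_single]
    rfl
  choose d hd using h
  refine ⟨b, d, fun j i => ?_⟩
  rw [hb, ← map_smul, ← hd j i]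
  have : U * (star U * A j * U) = A j * U := by
    rw [← mul_assoc, ← mul_assoc, Unitary.mul_star_self_of_mem hU, one_mul]
  exact (DFunLike.congr_fun this (e i)).symm

end

theorem proposition3p4 {H : Type*} [NormedAddCommGroup H] [InnerProductSpace ℂ H]
    [CompleteSpace H] (hH : ¬ FiniteDimensional ℂ H)
    {ι : Type*} (e : HilbertBasis ι ℂ H)
    {m : ℕ} (A : Fin m → H →L[ℂ] H)
    (hA : ∀ j, FiniteDimensional ℂ (LinearMap.range (A j : H →ₗ[ℂ] H))) :
    List.TFAE
      [IsCommutingNormalFamily A,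
       ∃ U ∈ unitary (H →L[ℂ] H), ∀ j, IsDiagonalOperator e (star U * A j * U),
       ∀ k : ℕ, 1 ≤ k → kNumericalRange k A = closure (kNumericalRange k A) ∧
         IsPolyhedral (kNumericalRange k A),
       ∃ k : ℕ, 1 ≤ k ∧ rangeSumDim A ≤ k ∧
         IsPolyhedral (convexHull ℝ (kNumericalRange k A))] := by
  tfae_have 1 → 2 := fun h => h.exists_unitary_isDiagonalOperator hH e hA
  tfae_have 2 → 3 := by
    rintro ⟨U, hU, h⟩ k hk
    obtain ⟨b, d, hd⟩ := exists_hilbertBasis_of_isDiagonalOperator e hU h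
    have hpoly := isPolyhedral_kNumericalRange_of_hilbertBasis hH b hA hd hk
    refine ⟨?_, hpoly⟩
    obtain ⟨F, hF, hFW⟩ := hpoly
    rw [hFW]
    exact (hF.isClosed_convexHull (𝕜 := ℝ)).closure_eq.symm
  tfae_have 3 → 4 := by
    intro h
    -- The maximum with `1` covers the case in which all operators vanish.
    refine ⟨max 1 (rangeSumDim A), le_max_left _ _, le_max_right _ _, ?_⟩
    obtain ⟨F, hF, hFW⟩ := (h _ (le_max_left 1 (rangeSumDim A))).2
    exact ⟨F, hF, by rw [hFW]; exact (convex_convexHull ℝ F).convexHull_eq⟩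
  tfae_have 4 → 1 := by
    rintro ⟨k, -, hk, hpoly⟩
    exact isCommutingNormalFamily_of_isPolyhedral_convexHull hH A hA hk hpoly
  tfae_finish
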